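/- For $u\in\mathbb{R}$ let $$\Phi(u) := \sum_{n=1}^\infty \left(2\pi^2 n^4 e^{9u} - 3\pi n^2 e^{5u}\right)\exp\left(-\pi n^2 e^{4u}\right),$$ and for $t\in\mathbb{R}$, $z\in\mathbb{C}$ let $$H_t(z) := \int_0^\infty e^{tu^2}\,\Phi(u)\cos(zu)\,du$$ (so that $H_0(z)=\frac18\,\xi\left(\frac12+\frac{iz}{2}\right)$, where $\xi$ is the Riemann $\xi$-function). **Proposition 3.3 (Zero-free region criterion).** Suppose that $t_0, X>0$ and $0<y_0\le 1$ obey the following hypotheses, in which $x,y,t$ are real and the conditions $y\le\sqrt{1-2t_0}$ and $y\le\sqrt{1-2t}$ are never satisfied (so the region in question is empty) when the quantity under the root is negative: (i) There are no zeroes $H_0(x+iy)=0$ with $0\le x\le X$ and $\sqrt{y_0^2+2t_0}\le y\le 1$. (ii) There are no zeroes $H_{t_0}(x+iy)=0$ with $x\ge X+\sqrt{1-y_0^2}$ and $y_0\le y\le\sqrt{1-2t_0}$. (iii) There are no zeroes $H_t(x+iy)=0$ with $X\le x\le X+\sqrt{1-y_0^2}$, $\sqrt{y_0^2+2(t_0-t)}\le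 y\le\sqrt{1-2t}$ and $0\le t\le t_0$. Then there are no zeroes $H_{t_0}(x+iy)=0$ with $x\in\mathbb{R}$ and $y\ge y_0$. -/

import Mathlib

namespace DeBruijnNewman

/-- The super-exponentially decaying kernel
`Φ(u) = ∑_{n ≥ 1} (2 π² n⁴ e^{9u} - 3 π n² e^{5u}) exp(-π n² e^{4u})`;
the summation index `n` below stands for `n + 1`. -/
noncomputable def Phi (u : ℝ) : ℝ :=
  ∑' n : ℕ,
    (2 * Real.pi ^ 2 * ((n : ℝ) + 1) ^ 4 * Real.exp (9 * u)
      - 3 * Real.pi * ((n : ℝ) + 1) ^ 2 * Real.exp (5 * u))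
      * Real.exp (-(Real.pi * ((n : ℝ) + 1) ^ 2 * Real.exp (4 * u)))

/-- The de Bruijn family `H_t(z) = ∫_0^∞ e^{t u²} Φ(u) cos(z u) du`, for `t ∈ ℝ` and `z ∈ ℂ`. -/
noncomputable def H (t : ℝ) (z : ℂ) : ℂ :=
  ∫ u in Set.Ioi (0 : ℝ),
    ((Real.exp (t * u ^ 2) * Phi u : ℝ) : ℂ) * Complex.cos (z * (u : ℂ))

end DeBruijnNewman

/-! Multiplying the integrand of `H 0` by `cosh (ε u)` replaces a function F by the mean of F(z +
iε) and F(z - iε), and `cosh (ε u) ^ n` approaches `exp (t u²)` when nε² = 2t and ε → 0. So `H t` is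
a limit of iterated vertical means of `H 0`, and its zeros can be followed in discrete time, on
polynomials.

Let P be a real polynomial. A zero x + iy, y > 0, of its mean forces |P| to agree at x + i(y ± ε).
Pairing each root r with its conjugate makes the upper value strictly larger unless some root has
(Im r)² ≥ (x - Re r)² + y² + ε² (`eval_verticalMean_ne_zero`). Hence for nonreal roots each step
lowers a bound B on (Im r)² by ε²: this is de Bruijn's theorem. The inequality also localizes. On
|Re z| ≤ X + W a sharper bound A - nε² persists as long as the barrier X ≤ |Re z| ≤ X + W stays free
of zeros, because roots outside the window are more than W away from any point with |Re z| < X, and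
W² ≥ B - A. Here B = 1, W² = 1 - y₀², and A is slightly below y₀² + 2t₀, so that at time t₀ the
bound is slightly below y₀².

The passage to `H` rests on polynomial approximation of `H 0` with roots among its zeros
(`exists_polynomial_approx`), on the strip |Im z| ≤ 1 for those zeros (nonvanishing of Γ and ζ), on
compactness, which turns the hypotheses into uniform margins, and on Hurwitz's theorem. Outside |x|
< X, hypotheses (ii), (iii) at time t₀ and de Bruijn's bound suffice. -/

/-! ### Vertical means of real polynomials and the motion of their roots -/

open Polynomial in
/-- The averaging operator `P(z) ↦ (P(z + iε) + P(z - iε)) / 2` on polynomials. -/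
noncomputable def Polynomial.verticalMean (ε : ℝ) (P : ℂ[X]) : ℂ[X] :=
  C (1 / 2) * (P.comp (X + C (ε * Complex.I)) + P.comp (X - C (ε * Complex.I)))

namespace Polynomial
open ComplexConjugate

lemma eval_verticalMean (ε : ℝ) (P : ℂ[X]) (z : ℂ) :
    (P.verticalMean ε).eval z
      = (P.eval (z + ε * Complex.I) + P.eval (z - ε * Complex.I)) / 2 := by
  simp [verticalMean]; ring

lemma verticalMean_conj {P : ℂ[X]} (hP : ∀ z, P.eval (conj z) = conj (P.eval z)) (ε : ℝ) (z : ℂ) :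
    (P.verticalMean ε).eval (conj z) = conj ((P.verticalMean ε).eval z) := by
  have h1 : conj z + ε * Complex.I = conj (z - ε * Complex.I) := by simp
  have h2 : conj z - ε * Complex.I = conj (z + ε * Complex.I) := by simp; ring
  rw [eval_verticalMean, eval_verticalMean, h1, h2, hP, hP, map_div₀, map_add, map_ofNat, add_comm]

/-- Since |P(z)| = |P(conj z)|, squaring pairs each root with its conjugate; closure of the root
multiset under conjugation is never needed. -/
lemma sq_norm_eval_eq_prod_roots {P : ℂ[X]} (hP : ∀ z, P.eval (conj z) = conj (P.eval z)) (z : ℂ) :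
    ‖P.eval z‖ ^ 2
      = ‖P.leadingCoeff‖ ^ 2 * (P.roots.map fun r => ‖z - r‖ * ‖z - conj r‖).prod := by
  have h : ∀ w : ℂ, ‖P.eval w‖ = ‖P.leadingCoeff‖ * (P.roots.map fun r => ‖w - r‖).prod := by
    intro w
    conv_lhs => rw [(IsAlgClosed.splits P).eq_prod_roots]
    rw [eval_mul, eval_C, norm_mul, eval_multiset_prod, Multiset.map_map]
    congr 1
    have := Multiset.prod_hom (P.roots.map (eval w ∘ fun x => X - C x)) (normHom : ℂ →*₀ ℝ)
    rw [Multiset.map_map] at this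
    simpa using this.symm
  have h2 : ‖P.eval z‖ = ‖P.eval (conj z)‖ := by rw [hP, RCLike.norm_conj]
  rw [sq]
  nth_rw 2 [h2]
  rw [h, h, Multiset.prod_map_mul]
  have h3 : (P.roots.map fun r => ‖conj z - r‖) = P.roots.map fun r => ‖z - conj r‖ := by
    refine Multiset.map_congr rfl fun r _ => ?_
    rw [← RCLike.norm_conj]; simp
  rw [h3]; ring

/-- The squares of the two sides differ by exactly 8εy((x - Re r)² + y² + ε² - (Im r)²). -/
lemma _root_.Complex.norm_sub_mul_norm_sub_conj_lt {ε y : ℝ} (hε : 0 < ε) (hy : 0 < y) {x : ℝ} {r : ℂ}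
    (h : r.im ^ 2 < (x - r.re) ^ 2 + y ^ 2 + ε ^ 2) :
    ‖(x + y * Complex.I - ε * Complex.I : ℂ) - r‖ * ‖(x + y * Complex.I - ε * Complex.I : ℂ) - conj r‖
      < ‖(x + y * Complex.I + ε * Complex.I : ℂ) - r‖
        * ‖(x + y * Complex.I + ε * Complex.I : ℂ) - conj r‖ := by
  refine lt_of_pow_lt_pow_left₀ 2 (by positivity) ?_
  simp only [mul_pow, Complex.sq_norm, Complex.normSq_apply]
  simp only [Complex.sub_re, Complex.add_re, Complex.mul_re, Complex.ofReal_re, Complex.I_re,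
    Complex.ofReal_im, Complex.I_im, Complex.sub_im, Complex.add_im, Complex.mul_im,
    Complex.conj_re, Complex.conj_im]
  have := mul_pos (mul_pos hε hy) (sub_pos.2 h)
  nlinarith [this]

lemma eval_verticalMean_ne_zero {P : ℂ[X]} (hP0 : P ≠ 0)
    (hP : ∀ z, P.eval (conj z) = conj (P.eval z)) {ε x y : ℝ} (hε : 0 < ε) (hy : 0 < y)
    (h : ∀ r : ℂ, P.eval r = 0 → r.im ^ 2 < (x - r.re) ^ 2 + y ^ 2 + ε ^ 2) :
    (P.verticalMean ε).eval (x + y * Complex.I) ≠ 0 := by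
  rw [eval_verticalMean]
  intro h0
  have h1 : P.eval (x + y * Complex.I + ε * Complex.I : ℂ)
      = -P.eval (x + y * Complex.I - ε * Complex.I : ℂ) := by
    linear_combination 2 * h0
  have h2 := congrArg (fun w => ‖w‖ ^ 2) h1
  simp only [norm_neg] at h2
  rw [sq_norm_eval_eq_prod_roots hP, sq_norm_eval_eq_prod_roots hP] at h2
  have hc : ‖P.leadingCoeff‖ ^ 2 ≠ 0 := by simpa using hP0
  have h3 := mul_left_cancel₀ hc h2
  -- Empty products are equal, so the strict comparison needs a root; a constant P is treated
  -- directly.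
  by_cases hr : P.roots = 0
  · have hdeg : P.natDegree = 0 := by
      rw [← (IsAlgClosed.splits P).natDegree_eq_card_roots.symm, hr]; rfl
    rw [eq_C_of_natDegree_eq_zero hdeg] at h1
    simp only [eval_C] at h1
    have h4 : P.coeff 0 = 0 := by linear_combination h1 / 2
    apply hP0
    rw [eq_C_of_natDegree_eq_zero hdeg, h4, C_0]
  · have key : ∀ s : Multiset ℂ, s ≠ 0 → (∀ r ∈ s, r.im ^ 2 < (x - r.re) ^ 2 + y ^ 2 + ε ^ 2) →
        (s.map fun r => ‖(x + y * Complex.I - ε * Complex.I : ℂ) - r‖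
          * ‖(x + y * Complex.I - ε * Complex.I : ℂ) - conj r‖).prod
        < (s.map fun r => ‖(x + y * Complex.I + ε * Complex.I : ℂ) - r‖
          * ‖(x + y * Complex.I + ε * Complex.I : ℂ) - conj r‖).prod := by
      intro s
      induction s using Multiset.induction with
      | empty => simp
      | cons a s ih =>
        intro _ hs
        simp only [Multiset.map_cons, Multiset.prod_cons]
        have ha := Complex.norm_sub_mul_norm_sub_conj_lt hε hy (hs a (by simp))
        by_cases hs0 : s = 0
        · simpa [hs0] using ha
        · have hb := ih hs0 fun r hr => hs r (by simp [hr])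
          refine mul_lt_mul'' ha hb (by positivity) (Multiset.prod_nonneg ?_)
          simp only [Multiset.mem_map]
          rintro _ ⟨r, _, rfl⟩
          positivity
    exact (key _ hr fun r hr => h r ((mem_roots hP0).1 hr)).ne' h3

/-- A point of the imaginary axis high above all roots of P cannot be a zero of the mean. -/
lemma verticalMean_ne_zero {P : ℂ[X]} (hP0 : P ≠ 0)
    (hP : ∀ z, P.eval (conj z) = conj (P.eval z)) {ε : ℝ} (hε : 0 < ε) :
    P.verticalMean ε ≠ 0 := by
  obtain ⟨M, hM⟩ : ∃ M : ℝ, ∀ r ∈ P.roots.toFinset, r.im ^ 2 ≤ M :=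
    ⟨∑ r ∈ P.roots.toFinset, r.im ^ 2, fun r hr =>
      Finset.single_le_sum (f := fun r : ℂ => r.im ^ 2) (fun _ _ => by positivity) hr⟩
  intro h0
  have := eval_verticalMean_ne_zero hP0 hP (x := 0) hε (y := |M| + 1) (by positivity) (by
    intro r hr
    have h1 := hM r (by simpa [hP0] using hr)
    have h2 := le_abs_self M
    nlinarith [sq_nonneg (0 - r.re), sq_nonneg M, abs_nonneg M, sq_abs M, sq_nonneg ε])
  simp [h0] at this

lemma iterate_verticalMean_conj {P : ℂ[X]} (hP : ∀ z, P.eval (conj z) = conj (P.eval z)) (ε : ℝ)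
    (n : ℕ) : ∀ z, (((verticalMean ε)^[n] P).eval (conj z)) = conj (((verticalMean ε)^[n] P).eval z) := by
  induction n with
  | zero => exact hP
  | succ n ih =>
    rw [Function.iterate_succ_apply']
    exact verticalMean_conj ih ε

lemma iterate_verticalMean_ne_zero {P : ℂ[X]} (hP0 : P ≠ 0)
    (hP : ∀ z, P.eval (conj z) = conj (P.eval z)) {ε : ℝ} (hε : 0 < ε) (n : ℕ) :
    (verticalMean ε)^[n] P ≠ 0 := by
  induction n with
  | zero => exact hP0
  | succ n ih =>
    rw [Function.iterate_succ_apply']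
    exact verticalMean_ne_zero ih (iterate_verticalMean_conj hP ε n) hε

/-- Polynomial form of de Bruijn's theorem: averaging shrinks the strip that holds the zeros. -/
lemma im_sq_le_of_eval_iterate_verticalMean_eq_zero {P : ℂ[X]} (hP0 : P ≠ 0)
    (hP : ∀ z, P.eval (conj z) = conj (P.eval z)) {ε B : ℝ} (hε : 0 < ε)
    (hB : ∀ r, P.eval r = 0 → r.im ^ 2 ≤ B) (n : ℕ) :
    ∀ r, ((verticalMean ε)^[n] P).eval r = 0 → r.im = 0 ∨ r.im ^ 2 ≤ B - n * ε ^ 2 := by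
  induction n with
  | zero => intro r hr; right; simpa using hB r hr
  | succ n ih =>
    have hn0 := iterate_verticalMean_ne_zero hP0 hP hε n
    have hnc := iterate_verticalMean_conj hP ε n
    have key : ∀ r, ((verticalMean ε)^[n + 1] P).eval r = 0 → 0 < r.im →
        r.im ^ 2 ≤ B - (n + 1 : ℕ) * ε ^ 2 := by
      intro r hr hpos
      by_contra! hlt
      push_cast at hlt
      rw [Function.iterate_succ_apply', ← Complex.re_add_im r] at hr
      refine eval_verticalMean_ne_zero hn0 hnc hε hpos ?_ hr
      intro s hs
      rcases ih s hs with h | h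
      · rw [h]; nlinarith [sq_nonneg (r.re - s.re), sq_nonneg ε]
      · nlinarith [sq_nonneg (r.re - s.re)]
    intro r hr
    rcases lt_trichotomy r.im 0 with h | h | h
    · right
      have := key (conj r) (by rw [iterate_verticalMean_conj hP ε, hr, map_zero]) (by simpa using h)
      simpa using this
    · exact .inl h
    · exact .inr (key r hr h)

/-- A barrier of width `W` around `|Re z| ≤ X` keeps zeros away from the region `A - nε² ≤ (Im z)²`. -/
lemma im_sq_lt_of_eval_iterate_verticalMean_eq_zero {P : ℂ[X]} (hP0 : P ≠ 0)
    (hP : ∀ z, P.eval (conj z) = conj (P.eval z)) {ε A B X W : ℝ} {N : ℕ} (hε : 0 < ε) (hW : 0 ≤ W)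
    (hB : ∀ r, P.eval r = 0 → r.im ^ 2 ≤ B) (hA : ∀ r, P.eval r = 0 → |r.re| ≤ X + W → r.im ^ 2 < A)
    (hAB : B - A ≤ W ^ 2) (hN : N * ε ^ 2 < A)
    (hbar : ∀ n ≤ N, ∀ r : ℂ, X ≤ |r.re| → |r.re| ≤ X + W → A - n * ε ^ 2 ≤ r.im ^ 2 →
      r.im ^ 2 ≤ B - n * ε ^ 2 → ((verticalMean ε)^[n] P).eval r ≠ 0) :
    ∀ n ≤ N, ∀ r, ((verticalMean ε)^[n] P).eval r = 0 → |r.re| ≤ X + W →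
      r.im ^ 2 < A - n * ε ^ 2 := by
  intro n
  induction n with
  | zero => intro _ r hr hX; simpa using hA r hr hX
  | succ n ih =>
    intro hnN
    have ih := ih (by omega)
    have hn0 := iterate_verticalMean_ne_zero hP0 hP hε n
    have hnc := iterate_verticalMean_conj hP ε n
    have hpos : 0 < A - (n + 1 : ℕ) * ε ^ 2 := by
      have : ((n + 1 : ℕ) : ℝ) ≤ N := by exact_mod_cast hnN
      nlinarith [sq_nonneg ε]
    have key : ∀ r, ((verticalMean ε)^[n + 1] P).eval r = 0 → |r.re| ≤ X + W → 0 < r.im →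
        r.im ^ 2 < A - (n + 1 : ℕ) * ε ^ 2 := by
      intro r hr hX him
      by_contra! hle
      -- Over the barrier the zero is excluded by `hbar`, whose upper height limit is the global de
      -- Bruijn bound.
      rcases le_or_gt X |r.re| with hXr | hXr
      · refine hbar (n + 1) hnN r hXr hX hle ?_ hr
        rcases im_sq_le_of_eval_iterate_verticalMean_eq_zero hP0 hP hε hB (n + 1) r hr with h | h
        · exact absurd h him.ne'
        · exact h
      rw [Function.iterate_succ_apply', ← Complex.re_add_im r] at hr
      refine eval_verticalMean_ne_zero hn0 hnc hε him ?_ hr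
      intro s hs
      push_cast at hle
      rcases le_or_gt |s.re| (X + W) with hsX | hsX
      · nlinarith [ih s hs hsX, sq_nonneg (r.re - s.re)]
      -- A root outside the window obeys only the weaker bound B - nε²; its horizontal distance,
      -- more than W, makes up for B - A.
      · have hdist : W ^ 2 < (r.re - s.re) ^ 2 := by
          rw [← sq_abs (r.re - s.re)]
          have : W < |r.re - s.re| := by
            have := abs_sub_abs_le_abs_sub s.re r.re
            rw [abs_sub_comm] at this
            linarith
          exact pow_lt_pow_left₀ this hW two_ne_zero
        rcases im_sq_le_of_eval_iterate_verticalMean_eq_zero hP0 hP hε hB n s hs with h | h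
        · rw [h]; nlinarith [sq_nonneg ε, sq_nonneg W, sq_nonneg (r.im)]
        · nlinarith
    intro r hr hX
    rcases lt_trichotomy r.im 0 with h | h | h
    · have := key (conj r) (by rw [iterate_verticalMean_conj hP ε, hr, map_zero]) (by simpa using hX)
        (by simpa using h)
      simpa using this
    · rw [h]; simpa using hpos
    · exact key r hr hX h

end Polynomial

/-! ### Polynomial approximation of even real entire functions -/

open Filter Topology Metric Set in
/-- The zeros of an entire function in a closed ball are finite in number. -/
lemma Differentiable.finite_zeros_inter_closedBall {F : ℂ → ℂ} (hF : Differentiable ℂ F) {a : ℂ}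
    (ha : F a ≠ 0) (ρ : ℝ) : {z | F z = 0 ∧ ‖z‖ ≤ ρ}.Finite := by
  by_contra hinf
  have hsub : {z | F z = 0 ∧ ‖z‖ ≤ ρ} ⊆ closedBall (0 : ℂ) ρ := fun z hz => by simpa using hz.2
  obtain ⟨x, -, hx⟩ := Set.Infinite.exists_accPt_of_subset_isCompact hinf
    (isCompact_closedBall (0 : ℂ) ρ) hsub
  have hfr : ∃ᶠ z in 𝓝[≠] x, F z = 0 :=
    (accPt_iff_frequently_nhdsNE.1 hx).mono fun z hz => hz.1
  have := AnalyticOnNhd.eqOn_zero_of_preconnected_of_frequently_eq_zero (f := F) (U := univ)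
    (fun z _ => hF.analyticAt z) isPreconnected_univ (mem_univ x) hfr
  exact ha (this (mem_univ a))

lemma Differentiable.analyticOrderAt_ne_top {F : ℂ → ℂ} (hF : Differentiable ℂ F) {a : ℂ}
    (ha : F a ≠ 0) (w : ℂ) : analyticOrderAt F w ≠ ⊤ := by
  intro h
  rw [AnalyticOnNhd.analyticOrderAt_eq_top_iff_eq_zero w fun z => hF.analyticAt z] at h
  exact ha (by rw [h]; rfl)

open ComplexConjugate in
lemma AnalyticAt.conj_comp_conj {g : ℂ → ℂ} {w : ℂ} (hg : AnalyticAt ℂ g w) :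
    AnalyticAt ℂ (fun z => conj (g (conj z))) (conj w) := by
  rw [Complex.analyticAt_iff_eventually_differentiableAt] at hg ⊢
  have hc : Filter.Tendsto (conj : ℂ → ℂ) (nhds (conj w)) (nhds w) := by
    simpa using Complex.continuous_conj.tendsto (conj w)
  filter_upwards [hc.eventually hg] with z hz
  have := hz.star_star
  rw [← starRingEnd_apply, Complex.conj_conj] at this
  exact this

open ComplexConjugate in
-- Conjugation is not holomorphic, so the local factorization is transported with cofactor `conj (g
-- (conj z))`. One inequality suffices, conjugation being an involution.
lemma analyticOrderAt_conj {F : ℂ → ℂ} (hF : Differentiable ℂ F)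
    (hconj : ∀ z, F (conj z) = conj (F z)) (w : ℂ) :
    analyticOrderAt F (conj w) = analyticOrderAt F w := by
  have key : ∀ w (n : ℕ), (n : ℕ∞) ≤ analyticOrderAt F w → (n : ℕ∞) ≤ analyticOrderAt F (conj w) := by
    intro w n h
    rw [natCast_le_analyticOrderAt (hF.analyticAt _)] at h ⊢
    obtain ⟨g, hg, hgF⟩ := h
    refine ⟨_, hg.conj_comp_conj, ?_⟩
    have hc : Filter.Tendsto (conj : ℂ → ℂ) (nhds (conj w)) (nhds w) := by
      simpa using Complex.continuous_conj.tendsto (conj w)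
    filter_upwards [hc.eventually hgF] with z hz
    rw [hconj] at hz
    have := congrArg conj hz
    simpa using this
  refine le_antisymm (ENat.forall_natCast_le_iff_le.1 fun n hn => ?_)
    (ENat.forall_natCast_le_iff_le.1 fun n hn => key w n hn)
  simpa using key _ n hn

lemma analyticOrderAt_neg_of_even {F : ℂ → ℂ} (heven : ∀ z, F (-z) = F z) (w : ℂ) :
    analyticOrderAt F (-w) = analyticOrderAt F w := by
  have h := analyticOrderAt_comp_of_deriv_ne_zero (f := F) (g := fun z : ℂ => -z) (z₀ := w)
    (by fun_prop) (by simp)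
  rw [← h]
  congr 1
  funext z
  exact heven z

/-- The canonical product of genus zero over the finite set `S` with the multiplicities of `F`. -/
noncomputable def zeroProduct (F : ℂ → ℂ) (S : Finset ℂ) : Polynomial ℂ :=
  ∏ w ∈ S, (1 - Polynomial.C w⁻¹ * Polynomial.X) ^ analyticOrderNatAt F w

lemma eval_zeroProduct (F : ℂ → ℂ) (S : Finset ℂ) (z : ℂ) :
    (zeroProduct F S).eval z = ∏ w ∈ S, (1 - w⁻¹ * z) ^ analyticOrderNatAt F w := by
  simp [zeroProduct, Polynomial.eval_prod]

lemma mem_of_eval_zeroProduct_eq_zero {F : ℂ → ℂ} {S : Finset ℂ} {z : ℂ}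
    (h : (zeroProduct F S).eval z = 0) : z ∈ S := by
  rw [eval_zeroProduct, Finset.prod_eq_zero_iff] at h
  obtain ⟨w, hw, h⟩ := h
  have h1 : 1 - w⁻¹ * z = 0 := by
    by_contra h1
    exact pow_ne_zero _ h1 h
  -- With `0⁻¹ = 0` the factor at w = 0 would be identically 1.
  have hw0 : w ≠ 0 := by rintro rfl; simp at h1
  have : z = w := by field_simp at h1; linear_combination -h1
  rwa [this]

open ComplexConjugate in
lemma eval_zeroProduct_conj {F : ℂ → ℂ} (hF : Differentiable ℂ F)
    (hconj : ∀ z, F (conj z) = conj (F z)) {S : Finset ℂ} (hS : ∀ w ∈ S, conj w ∈ S) (z : ℂ) :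
    (zeroProduct F S).eval (conj z) = conj ((zeroProduct F S).eval z) := by
  rw [eval_zeroProduct, eval_zeroProduct, map_prod]
  refine Finset.prod_bij' (fun w _ => conj w) (fun w _ => conj w) hS hS (by simp) (by simp) ?_
  intro w _
  simp [analyticOrderNatAt, analyticOrderAt_conj hF hconj]

lemma eval_zeroProduct_neg {F : ℂ → ℂ} (heven : ∀ z, F (-z) = F z) {S : Finset ℂ}
    (hS : ∀ w ∈ S, -w ∈ S) (z : ℂ) :
    (zeroProduct F S).eval (-z) = (zeroProduct F S).eval z := by
  rw [eval_zeroProduct, eval_zeroProduct]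
  refine Finset.prod_bij' (fun w _ => -w) (fun w _ => -w) hS hS (by simp) (by simp) ?_
  intro w _
  simp [analyticOrderNatAt, analyticOrderAt_neg_of_even heven, inv_neg]

open Topology in
/-- Dividing an entire function by its zeros on a finite set leaves an entire function. -/
lemma exists_eq_zeroProduct_mul {F : ℂ → ℂ} (hF : Differentiable ℂ F) (h0 : F 0 ≠ 0)
    (S : Finset ℂ) (hS : 0 ∉ S) :
    ∃ h : ℂ → ℂ, Differentiable ℂ h ∧ (∀ z, F z = (zeroProduct F S).eval z * h z) ∧
      ∀ w ∈ S, h w ≠ 0 := by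
  induction S using Finset.induction_on with
  | empty => exact ⟨F, hF, by simp [zeroProduct], by simp⟩
  | insert a S ha ih =>
    obtain ⟨h, hh, hFh, hS'⟩ := ih fun h => hS (by simp [h])
    have ha0 : a ≠ 0 := by rintro rfl; simp at hS
    have hord : analyticOrderAt F a = analyticOrderAt h a := by
      have : F = (fun z => (zeroProduct F S).eval z) * h := funext hFh
      have hQ := (Polynomial.differentiable (zeroProduct F S)).analyticAt a
      rw [this, analyticOrderAt_mul hQ (hh.analyticAt a), hQ.analyticOrderAt_eq_zero.2, zero_add]
      exact fun h => ha (mem_of_eval_zeroProduct_eq_zero h)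
    obtain ⟨g, hg, hga, hgh⟩ := ((hh.analyticAt a).analyticOrderAt_ne_top).1
      (hord ▸ hF.analyticOrderAt_ne_top h0 a)
    set n := analyticOrderNatAt F a with hn
    have hnh : analyticOrderNatAt h a = n := by simp [hn, analyticOrderNatAt, hord]
    rw [hnh] at hgh
    have hc : (-a) ^ n ≠ 0 := pow_ne_zero _ (neg_ne_zero.2 ha0)
    -- The quotient of h by (1 - z/a)^n, with the removable singularity at a filled from the local
    -- factorization.
    let k : ℂ → ℂ := fun z => if z = a then (-a) ^ n * g a else (-a) ^ n * (h z / (z - a) ^ n)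
    have hk : ∀ z, h z = (1 - a⁻¹ * z) ^ n * k z := by
      intro z
      by_cases hz : z = a
      · subst hz
        have := hgh.self_of_nhds
        simp only [k, if_true, inv_mul_cancel₀ ha0, sub_self, smul_eq_mul] at this ⊢
        rw [this]
        rcases Nat.eq_zero_or_pos n with h | h
        · simp [h]
        · simp [h.ne']
      · have hz' : (z - a) ^ n ≠ 0 := pow_ne_zero _ (sub_ne_zero.2 hz)
        simp only [k, if_neg hz]
        have : (1 - a⁻¹ * z) ^ n * (-a) ^ n = (z - a) ^ n := by
          rw [← mul_pow]; congr 1; field_simp; ring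
        rw [← mul_assoc, this]
        field_simp
    refine ⟨k, ?_, ?_, ?_⟩
    · intro z
      by_cases hz : z = a
      · subst hz
        have : k =ᶠ[𝓝 z] fun y => (-z) ^ n * g y := by
          filter_upwards [hgh] with y hy
          by_cases hyz : y = z
          · simp [k, hyz]
          · have hz' : (y - z) ^ n ≠ 0 := pow_ne_zero _ (sub_ne_zero.2 hyz)
            simp only [k, if_neg hyz, hy, smul_eq_mul]
            field_simp
        exact (hg.differentiableAt.const_mul _).congr_of_eventuallyEq this
      · have : k =ᶠ[𝓝 z] fun y => (-a) ^ n * (h y / (y - a) ^ n) := by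
          filter_upwards [isOpen_ne.mem_nhds hz] with y hy
          exact if_neg hy
        refine DifferentiableAt.congr_of_eventuallyEq ?_ this
        refine DifferentiableAt.const_mul (DifferentiableAt.fun_div (hh z) (by fun_prop) ?_) _
        exact pow_ne_zero _ (sub_ne_zero.2 hz)
    · intro z
      rw [hFh, hk, zeroProduct, zeroProduct, Finset.prod_insert ha]
      simp only [Polynomial.eval_mul, Polynomial.eval_pow, Polynomial.eval_sub,
        Polynomial.eval_one, Polynomial.eval_C, Polynomial.eval_X]
      ring
    · intro w hw
      rcases Finset.mem_insert.1 hw with rfl | hw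
      · simpa [k] using ⟨fun h => (ha0 h).elim, hga⟩
      · intro hkw
        exact hS' w hw (by rw [hk, hkw, mul_zero])

open Metric in
/-- A zero-free holomorphic function on a disc has a holomorphic logarithm. -/
lemma DifferentiableOn.exists_exp_eq {h : ℂ → ℂ} {ρ : ℝ} (hρ : 0 < ρ)
    (hh : DifferentiableOn ℂ h (ball 0 ρ)) (hne : ∀ z ∈ ball (0 : ℂ) ρ, h z ≠ 0) :
    ∃ g : ℂ → ℂ, DifferentiableOn ℂ g (ball 0 ρ) ∧ g 0 = 0 ∧
      ∀ z ∈ ball (0 : ℂ) ρ, h z = h 0 * Complex.exp (g z) := by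
  have hd : DifferentiableOn ℂ (fun z => _root_.deriv h z / h z) (ball 0 ρ) :=
    DifferentiableOn.fun_div (hh.deriv isOpen_ball) hh hne
  obtain ⟨g, hg0, hg⟩ := hd.isExactOn_ball.with_val_at 0 0
  have h0 : (0 : ℂ) ∈ ball (0 : ℂ) ρ := by simpa
  refine ⟨g, fun z hz => (hg z hz).differentiableAt.differentiableWithinAt, hg0, ?_⟩
  intro z hz
  have hder : ∀ z ∈ ball (0 : ℂ) ρ, HasDerivAt (fun z => h z * Complex.exp (-g z)) 0 z := by
    intro z hz
    have h1 := (hh.differentiableAt (isOpen_ball.mem_nhds hz)).hasDerivAt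
    refine (h1.fun_mul (hg z hz).neg.cexp).congr_deriv ?_
    have h2 : h z * (_root_.deriv h z / h z) = _root_.deriv h z := mul_div_cancel₀ _ (hne z hz)
    linear_combination -Complex.exp (-g z) * h2
  have hconst := (convex_ball (0 : ℂ) ρ).is_const_of_fderivWithin_eq_zero (𝕜 := ℂ)
    (f := fun z => h z * Complex.exp (-g z))
    (fun z hz => (hder z hz).differentiableAt.differentiableWithinAt)
    (fun z hz => by
      rw [fderivWithin_of_isOpen isOpen_ball hz]
      ext
      simpa using (hder z hz).deriv) hz h0
  simp only [hg0, neg_zero, Complex.exp_zero, mul_one] at hconst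
  rw [← hconst, mul_assoc, ← Complex.exp_add]
  simp

open ComplexConjugate Metric Set in
/-- An even real entire function of growth below order two is a locally uniform limit of real
polynomials whose zeros are among its own. -/
lemma exists_polynomial_approx {F : ℂ → ℂ} (hF : Differentiable ℂ F) (h0 : F 0 ≠ 0)
    (heven : ∀ z, F (-z) = F z) (hconj : ∀ z, F (conj z) = conj (F z))
    (hgrowth : ∀ c : ℝ, 0 < c → ∃ C : ℝ, ∀ z, ‖F z‖ ≤ C * Real.exp (c * ‖z‖ ^ 2))
    {R η : ℝ} (hR : 0 < R) (hη : 0 < η) :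
    ∃ P : Polynomial ℂ, P ≠ 0 ∧ (∀ z, P.eval (conj z) = conj (P.eval z)) ∧
      (∀ z, P.eval z = 0 → F z = 0) ∧ ∀ z, ‖z‖ ≤ R → ‖P.eval z - F z‖ ≤ η := by
  obtain ⟨K, hK⟩ := (isCompact_closedBall (0 : ℂ) R).exists_bound_of_continuousOn
    hF.continuous.continuousOn
  have hK0 : 0 ≤ K := (norm_nonneg _).trans (hK 0 (by simp [hR.le]))
  -- Target size of the logarithm g on |z| ≤ R: then |exp(-g) - 1| ≤ 2τ, and 2τK ≤ η.
  set τ : ℝ := min 1 (η / (2 * (K + 1))) with hτ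
  have hτ0 : 0 < τ := by positivity
  -- The final Schwarz bound is 8R²A/ρ². This growth rate, taken on |z| = 2ρ, contributes τ/2 to it;
  -- the choice of ρ makes the share of L + 1 at most τ/2.
  obtain ⟨C, hC⟩ := hgrowth (τ / (64 * R ^ 2)) (by positivity)
  have hF0 : 0 < ‖F 0‖ := norm_pos_iff.2 h0
  have hC1 : 1 ≤ C / ‖F 0‖ := by
    rw [le_div_iff₀ hF0, one_mul]; simpa using hC 0
  set L : ℝ := Real.log (C / ‖F 0‖) with hL
  have hL0 : 0 ≤ L := Real.log_nonneg hC1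
  obtain ⟨ρ, hρR, hρL⟩ : ∃ ρ : ℝ, 2 * R < ρ ∧ 16 * R ^ 2 * (L + 1) ≤ τ * ρ ^ 2 := by
    obtain ⟨q, hq⟩ : ∃ q : ℝ, 16 * R ^ 2 * (L + 1) = τ * q :=
      ⟨16 * R ^ 2 * (L + 1) / τ, by field_simp⟩
    have hq0 : 0 < q := pos_of_mul_pos_right (hq ▸ by positivity) hτ0.le
    refine ⟨2 * R + 1 + q, by linarith, ?_⟩
    rw [hq]
    exact mul_le_mul_of_nonneg_left (by nlinarith) hτ0.le
  have hρ : 0 < ρ := by linarith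
  have hfin := hF.finite_zeros_inter_closedBall h0 ρ
  set S := hfin.toFinset with hS
  have hmem : ∀ w, w ∈ S ↔ F w = 0 ∧ ‖w‖ ≤ ρ := fun w => by simp [hS]
  obtain ⟨h, hh, hFh, hne⟩ := exists_eq_zeroProduct_mul hF h0 S (by simp [hmem, h0])
  set Q := zeroProduct F S with hQ
  have hQ0 : Q.eval 0 = 1 := by simp [hQ, eval_zeroProduct]
  have hh0 : h 0 = F 0 := by rw [hFh, hQ0, one_mul]
  have hhne : ∀ z ∈ ball (0 : ℂ) ρ, h z ≠ 0 := by
    intro z hz hz0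
    have hFz : F z = 0 := by rw [hFh, hz0, mul_zero]
    exact hne z ((hmem z).2 ⟨hFz, by simpa using (mem_ball_zero_iff.1 hz).le⟩) hz0
  have hQneg : ∀ z, Q.eval (-z) = Q.eval z :=
    eval_zeroProduct_neg heven fun w hw => by
      rw [hmem] at hw ⊢; simpa [heven] using hw
  have hQconj : ∀ z, Q.eval (conj z) = conj (Q.eval z) :=
    eval_zeroProduct_conj hF hconj fun w hw => by
      rw [hmem] at hw ⊢; simpa [hconj] using hw
  obtain ⟨g, hg, hg0, hgh⟩ := hh.differentiableOn.exists_exp_eq hρ hhne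
  -- On |w| = 2ρ every factor satisfies |1 - w/a| ≥ 1, since |a| ≤ ρ; so |h| ≤ |F| there, and the
  -- maximum principle carries the bound inside.
  have hbound : ∀ z ∈ closedBall (0 : ℂ) (2 * ρ), ‖h z‖ ≤ C * Real.exp (τ / (64 * R ^ 2) * (2 * ρ) ^ 2) := by
    intro z hz
    have hcl : z ∈ closure (ball (0 : ℂ) (2 * ρ)) := by
      rwa [closure_ball _ (by positivity)]
    refine Complex.norm_le_of_forall_mem_frontier_norm_le isBounded_ball
      (hh.diffContOnCl) ?_ hcl
    intro w hw
    rw [frontier_ball _ (by positivity), mem_sphere_zero_iff_norm] at hw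
    have hQ1 : 1 ≤ ‖Q.eval w‖ := by
      rw [hQ, eval_zeroProduct, norm_prod]
      rw [← Finset.prod_const_one (s := S)]
      refine Finset.prod_le_prod (fun _ _ => zero_le_one) fun a ha => ?_
      rw [norm_pow]
      refine one_le_pow₀ ?_
      have ha' := (hmem a).1 ha
      have ha0 : 0 < ‖a‖ := norm_pos_iff.2 fun h => h0 (h ▸ ha'.1)
      have h1 : 2 ≤ ‖a⁻¹ * w‖ := by
        rw [norm_mul, norm_inv, hw, inv_mul_eq_div, le_div_iff₀ ha0]; linarith [ha'.2]
      have h2 := norm_sub_norm_le (a⁻¹ * w) 1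
      rw [norm_sub_rev, norm_one] at h2
      linarith
    calc ‖h w‖ ≤ ‖Q.eval w‖ * ‖h w‖ := le_mul_of_one_le_left (norm_nonneg _) hQ1
      _ = ‖F w‖ := by rw [← norm_mul, ← hFh]
      _ ≤ _ := by simpa [hw] using hC w
  set A : ℝ := L + 1 + τ / (64 * R ^ 2) * (2 * ρ) ^ 2 with hA
  have hA0 : 0 < A := by positivity
  have hre : MapsTo g (ball 0 ρ) {z | z.re ≤ A} := by
    intro z hz
    have h1 := hbound z (by simp at hz ⊢; linarith)
    rw [hgh z hz, norm_mul, Complex.norm_exp, hh0] at h1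
    have hCpos : 0 < C / ‖F 0‖ := by linarith
    have h2 : Real.exp (g z).re ≤ Real.exp (L + τ / (64 * R ^ 2) * (2 * ρ) ^ 2) := by
      rw [Real.exp_add, hL, Real.exp_log hCpos, div_mul_eq_mul_div, le_div_iff₀ hF0]
      linarith
    have h3 := Real.exp_le_exp.1 h2
    show (g z).re ≤ A
    linarith
  have hmaps : MapsTo g (ball 0 (ρ / 2)) (closedBall (g 0) (2 * A)) := by
    intro z hz
    rw [hg0, mem_closedBall_zero_iff]
    have hz' : ‖z‖ < ρ / 2 := by simpa using hz
    refine (Complex.borelCaratheodory_zero hA0 hg hre hρ (by simp; linarith) hg0).trans ?_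
    rw [div_le_iff₀ (by linarith)]
    nlinarith
  -- Evenness removes the linear term of g, so Schwarz's lemma gains (|z|/ρ)², matching the ρ²
  -- growth of A; a gain of |z|/ρ would not suffice.
  have hderiv : deriv g 0 = 0 := by
    have heven0 : ∀ f : ℂ → ℂ, (∀ z, f (-z) = f z) → deriv f 0 = 0 := by
      intro f hf
      have h1 := deriv_comp_neg f 0
      simp only [hf, neg_zero] at h1
      exact CharZero.eq_neg_self_iff.1 h1
    have hdh : deriv h 0 = 0 := by
      have h1 : deriv F 0 = _ := congrArg (fun f => deriv f 0) (funext hFh)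
      rw [heven0 F heven, deriv_fun_mul Q.differentiable.differentiableAt (hh 0),
        heven0 _ hQneg, hQ0] at h1
      simpa using h1.symm
    have hdg := (hg.differentiableAt (isOpen_ball.mem_nhds (mem_ball_self hρ))).hasDerivAt
    have h1 := (hdg.cexp.const_mul (h 0)).congr_of_eventuallyEq (f₁ := h)
      (Filter.eventually_of_mem (isOpen_ball.mem_nhds (mem_ball_self hρ)) hgh)
    rw [h1.deriv, hg0, hh0] at hdh
    simpa [h0] using hdh
  have hlittle : (fun z => g z - g 0) =o[nhds 0] fun z => ‖z - 0‖ ^ 1 := by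
    have hd := (hg.differentiableAt (isOpen_ball.mem_nhds (by simpa : (0 : ℂ) ∈ ball (0 : ℂ) ρ))).hasDerivAt
    rw [hderiv, hasDerivAt_iff_isLittleO] at hd
    simpa using hd.norm_right
  have hsmall : ∀ z, ‖z‖ ≤ R → ‖g z‖ ≤ τ := by
    intro z hz
    have hzb : z ∈ ball (0 : ℂ) (ρ / 2) := by simp; linarith
    have h1 := Complex.dist_le_mul_div_pow_of_mapsTo_ball_of_isLittleO
      (hg.mono (ball_subset_ball (by linarith))) hmaps hlittle hzb
    rw [hg0, dist_zero_right, dist_zero_right] at h1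
    refine h1.trans ?_
    have h2 : (‖z‖ / (ρ / 2)) ^ (1 + 1) ≤ (R / (ρ / 2)) ^ 2 := by
      norm_num; gcongr
    refine (mul_le_mul_of_nonneg_left h2 (by positivity)).trans ?_
    have h3 : 2 * A * (R / (ρ / 2)) ^ 2 = (16 * R ^ 2 * (L + 1) / 2 + τ / 2 * ρ ^ 2) / ρ ^ 2 := by
      rw [hA]; field_simp; ring
    rw [h3, div_le_iff₀ (by positivity)]
    linarith
  refine ⟨Polynomial.C (F 0) * Q, ?_, ?_, ?_, ?_⟩
  · intro h
    have := congrArg (Polynomial.eval 0) h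
    simp [hQ0, h0] at this
  · intro z
    have : conj (F 0) = F 0 := by rw [← hconj]; simp
    simp [hQconj, this]
  · intro z hz
    simp only [Polynomial.eval_mul, Polynomial.eval_C, mul_eq_zero, h0, false_or] at hz
    exact ((hmem z).1 (mem_of_eval_zeroProduct_eq_zero hz)).1
  · intro z hz
    have hzb : z ∈ ball (0 : ℂ) ρ := by simp; linarith
    have h1 := hsmall z hz
    have h2 : (Polynomial.C (F 0) * Q).eval z - F z = F z * (Complex.exp (-g z) - 1) := by
      rw [Polynomial.eval_mul, Polynomial.eval_C]
      nth_rw 3 [hFh]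
      rw [mul_sub, mul_assoc, hgh z hzb, hh0, mul_one, hFh z, hgh z hzb, hh0]
      have : Complex.exp (g z) * Complex.exp (-g z) = 1 := by rw [← Complex.exp_add]; simp
      linear_combination (-(Q.eval z * F 0)) * this
    rw [h2, norm_mul]
    have h3 := Complex.norm_exp_sub_one_le (x := -g z) (by rw [norm_neg]; exact h1.trans (min_le_left _ _))
    rw [norm_neg] at h3
    have h4 : τ * (2 * (K + 1)) ≤ η := by
      rw [← le_div_iff₀ (by positivity)]; exact min_le_right _ _
    have h5 : ‖F z‖ ≤ K := hK z (by simpa using hz)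
    calc ‖F z‖ * ‖Complex.exp (-g z) - 1‖ ≤ K * (2 * τ) := by gcongr; linarith
      _ ≤ η := by linarith

/-! ### The kernel Φ: evenness, positivity and decay -/

namespace DeBruijnNewman
open Real

/-- The exponent `π (n + 1)² e^{4u}` of the `n`-th term of the theta series. -/
noncomputable def expo (n : ℕ) (u : ℝ) : ℝ := π * ((n : ℝ) + 1) ^ 2 * exp (4 * u)

lemma expo_pos (n : ℕ) (u : ℝ) : 0 < expo n u := by unfold expo; positivity

lemma hasDerivAt_expo (n : ℕ) (u : ℝ) : HasDerivAt (expo n) (4 * expo n u) u := by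
  have := (((hasDerivAt_id u).const_mul 4).exp).const_mul (π * ((n : ℝ) + 1) ^ 2)
  refine this.congr_deriv ?_
  simp [expo]; ring

/-- The `n`-th term of the series for `Φ`. -/
noncomputable def phiTerm (n : ℕ) (u : ℝ) : ℝ :=
  (2 * expo n u ^ 2 - 3 * expo n u) * exp u * exp (-expo n u)

lemma Phi_eq_tsum (u : ℝ) : Phi u = ∑' n, phiTerm n u := by
  unfold Phi phiTerm expo
  refine tsum_congr fun n => ?_
  have h9 : exp (9 * u) = exp (4 * u) ^ 2 * exp u := by
    rw [← exp_nat_mul, ← exp_add]; congr 1; push_cast; ring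
  have h5 : exp (5 * u) = exp (4 * u) * exp u := by
    rw [← exp_add]; congr 1; ring
  rw [h9, h5]; ring

lemma abs_quadratic_mul_exp_neg_le {a c₀ c₁ c₂ : ℝ} (ha : 0 < a) :
    |c₀ + c₁ * a + c₂ * a ^ 2| * exp (-a) ≤ (|c₀| + 2 * |c₁| + 6 * |c₂|) / a := by
  have h1 := pow_div_factorial_le_exp a ha.le 1
  have h2 := pow_div_factorial_le_exp a ha.le 2
  have h3 := pow_div_factorial_le_exp a ha.le 3
  simp [Nat.factorial] at h1 h2 h3
  rw [exp_neg, ← div_eq_mul_inv, div_le_div_iff₀ (exp_pos a) ha]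
  have h4 : |c₀ + c₁ * a + c₂ * a ^ 2| ≤ |c₀| + |c₁| * a + |c₂| * a ^ 2 := by
    refine (abs_add_three _ _ _).trans (le_of_eq ?_)
    rw [abs_mul, abs_mul, abs_of_pos ha, abs_of_pos (pow_pos ha 2)]
  calc |c₀ + c₁ * a + c₂ * a ^ 2| * a ≤ (|c₀| + |c₁| * a + |c₂| * a ^ 2) * a := by gcongr
    _ = |c₀| * a + |c₁| * a ^ 2 + |c₂| * a ^ 3 := by ring
    _ ≤ |c₀| * exp a + |c₁| * (2 * exp a) + |c₂| * (6 * exp a) := by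
      gcongr <;> linarith
    _ = _ := by ring

/-- A summable majorant uniform in u on bounded intervals, which permits termwise differentiation
and gives continuity. -/
lemma quadratic_term_le {c₀ c₁ c₂ M : ℝ} {n : ℕ} {u : ℝ} (hu : u ∈ Set.Ioo (-M) M) :
    ‖(c₀ + c₁ * expo n u + c₂ * expo n u ^ 2) * exp u * exp (-expo n u)‖
      ≤ (|c₀| + 2 * |c₁| + 6 * |c₂|) * exp M / (π * exp (-(4 * M))) * (1 / ((n : ℝ) + 1) ^ 2) := by
  have h1 := abs_quadratic_mul_exp_neg_le (c₀ := c₀) (c₁ := c₁) (c₂ := c₂) (expo_pos n u)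
  rw [norm_mul, norm_mul, norm_eq_abs, norm_eq_abs, norm_eq_abs, abs_exp, abs_exp]
  have h2 : π * exp (-(4 * M)) * ((n : ℝ) + 1) ^ 2 ≤ expo n u := by
    have : exp (-(4 * M)) ≤ exp (4 * u) := exp_le_exp.2 (by linarith [hu.1])
    calc _ = π * ((n : ℝ) + 1) ^ 2 * exp (-(4 * M)) := by ring
      _ ≤ _ := by unfold expo; gcongr
  have h3 : exp u ≤ exp M := exp_le_exp.2 hu.2.le
  calc _ = exp u * (|c₀ + c₁ * expo n u + c₂ * expo n u ^ 2| * exp (-expo n u)) := by ring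
    _ ≤ exp M * ((|c₀| + 2 * |c₁| + 6 * |c₂|) / (π * exp (-(4 * M)) * ((n : ℝ) + 1) ^ 2)) := by
      gcongr
      exact h1.trans (by gcongr)
    _ = _ := by field_simp

lemma summable_one_div_succ_sq : Summable fun n : ℕ => 1 / ((n : ℝ) + 1) ^ 2 := by
  have := (summable_nat_add_iff 1).2 (Real.summable_one_div_nat_pow.2 one_lt_two)
  simpa using this

lemma summable_quadratic_term (c₀ c₁ c₂ u : ℝ) :
    Summable fun n => (c₀ + c₁ * expo n u + c₂ * expo n u ^ 2) * exp u * exp (-expo n u) :=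
  Summable.of_norm_bounded (summable_one_div_succ_sq.mul_left _) fun n =>
    quadratic_term_le (M := |u| + 1) ⟨by linarith [neg_abs_le u], by linarith [le_abs_self u]⟩

lemma hasDerivAt_quadratic_term (c₀ c₁ : ℝ) (n : ℕ) (u : ℝ) :
    HasDerivAt (fun u => (c₀ + c₁ * expo n u) * exp u * exp (-expo n u))
      ((c₀ + (5 * c₁ - 4 * c₀) * expo n u + (-4 * c₁) * expo n u ^ 2) * exp u * exp (-expo n u)) u := by
  have ha := hasDerivAt_expo n u
  refine ((((ha.const_mul c₁).const_add c₀).fun_mul (hasDerivAt_exp u)).fun_mul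
    ha.fun_neg.exp).congr_deriv ?_
  ring

lemma hasDerivAt_tsum_quadratic_term (c₀ c₁ u : ℝ) :
    HasDerivAt (fun u => ∑' n, (c₀ + c₁ * expo n u) * exp u * exp (-expo n u))
      (∑' n, (c₀ + (5 * c₁ - 4 * c₀) * expo n u + (-4 * c₁) * expo n u ^ 2) * exp u
        * exp (-expo n u)) u := by
  have hu : u ∈ Set.Ioo (-(|u| + 1)) (|u| + 1) :=
    ⟨by linarith [neg_abs_le u], by linarith [le_abs_self u]⟩
  refine hasDerivAt_tsum_of_isPreconnected (summable_one_div_succ_sq.mul_left _) isOpen_Ioo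
    isPreconnected_Ioo (fun n y _ => hasDerivAt_quadratic_term c₀ c₁ n y)
    (fun n y hy => quadratic_term_le hy) hu ?_ hu
  simpa using summable_quadratic_term c₀ c₁ 0 u

/-- `e^u θ(e^{4u})`, with `θ` the Jacobi theta function. -/
noncomputable def thetaSum (u : ℝ) : ℝ := exp u + 2 * ∑' n, exp u * exp (-expo n u)

lemma thetaSum_eq_tsum_int (u : ℝ) :
    thetaSum u = exp u * ∑' n : ℤ, exp (-π * exp (4 * u) * (n : ℝ) ^ 2) := by
  have hs : Summable fun n : ℕ => exp (-expo n u) := by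
    have h := (summable_quadratic_term 1 0 0 u).mul_left (exp (-u))
    refine h.congr fun n => ?_
    have : exp (-u) * exp u = 1 := by rw [← exp_add]; simp
    linear_combination exp (-expo n u) * this
  have h1 : HasSum (fun n : ℕ => exp (-π * exp (4 * u) * (((n : ℤ) + 1 : ℤ) : ℝ) ^ 2))
      (∑' n, exp (-expo n u)) := by
    refine hs.hasSum.congr_fun ?_
    intro n
    unfold expo; push_cast; ring_nf
  have h2 : HasSum (fun n : ℕ => exp (-π * exp (4 * u) * ((-((n : ℤ) + 1) : ℤ) : ℝ) ^ 2))
      (∑' n, exp (-expo n u)) := by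
    convert h1 using 2 with n
    push_cast; ring_nf
  have h3 := HasSum.of_add_one_of_neg_add_one (f := fun n : ℤ => exp (-π * exp (4 * u) * (n : ℝ) ^ 2)) h1 h2
  rw [h3.tsum_eq, thetaSum, tsum_mul_left]
  simp; ring

/-- Jacobi's identity θ(1/x) = √x θ(x) at x = e^{4u}; the prefactor e^u = x^{1/4} makes it
symmetric. -/
lemma thetaSum_neg (u : ℝ) : thetaSum (-u) = thetaSum u := by
  rw [thetaSum_eq_tsum_int, thetaSum_eq_tsum_int, tsum_exp_neg_mul_int_sq (exp_pos _)]
  have h1 : exp (4 * -u) ^ (1 / 2 : ℝ) = exp (-(2 * u)) := by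
    rw [← exp_mul]; congr 1; ring
  have h2 : ∀ n : ℤ, -π / exp (4 * -u) * (n : ℝ) ^ 2 = -π * exp (4 * u) * (n : ℝ) ^ 2 := by
    intro n
    rw [show 4 * -u = -(4 * u) by ring, exp_neg, div_inv_eq_mul]
  simp only [h1, h2]
  rw [← mul_assoc, one_div, ← exp_neg, ← exp_add]
  congr 2; ring

lemma hasDerivAt_thetaSum (u : ℝ) : HasDerivAt thetaSum
    (exp u + 2 * ∑' n, (1 - 4 * expo n u) * exp u * exp (-expo n u)) u := by
  have h := hasDerivAt_tsum_quadratic_term 1 0 u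
  simp only [zero_mul, add_zero, one_mul, mul_zero, mul_one, zero_sub, ← sub_eq_add_neg,
    neg_mul] at h
  exact (hasDerivAt_exp u).fun_add (h.const_mul 2)

lemma hasDerivAt_deriv_thetaSum (u : ℝ) : HasDerivAt (deriv thetaSum)
    (exp u + 2 * ∑' n, (1 - 24 * expo n u + 16 * expo n u ^ 2) * exp u * exp (-expo n u)) u := by
  rw [show deriv thetaSum = _ from funext fun u => (hasDerivAt_thetaSum u).deriv]
  have h := hasDerivAt_tsum_quadratic_term 1 (-4) u
  norm_num at h
  simp only [← sub_eq_add_neg] at h ⊢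
  exact (hasDerivAt_exp u).fun_add (h.const_mul 2)

lemma summable_phiTerm (u : ℝ) : Summable fun n => phiTerm n u := by
  refine (summable_quadratic_term 0 (-3) 2 u).congr fun n => ?_
  unfold phiTerm; ring

/-- The operator d²/du² - 1 kills e^u and turns each theta term into 8 `phiTerm`. Being even, it
passes the symmetry of `thetaSum` on to Φ. -/
lemma Phi_eq_thetaSum (u : ℝ) : 16 * Phi u = deriv (deriv thetaSum) u - thetaSum u := by
  have h2 : Summable fun n => (1 - 24 * expo n u + 16 * expo n u ^ 2) * exp u * exp (-expo n u) := by
    refine (summable_quadratic_term 1 (-24) 16 u).congr fun n => ?_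
    ring
  have h0 : Summable fun n => exp u * exp (-expo n u) := by
    refine (summable_quadratic_term 1 0 0 u).congr fun n => ?_
    ring
  rw [(hasDerivAt_deriv_thetaSum u).deriv, thetaSum, Phi_eq_tsum]
  have h4 : ∑' n, 8 * phiTerm n u = ∑' n, ((1 - 24 * expo n u + 16 * expo n u ^ 2) * exp u
      * exp (-expo n u) - exp u * exp (-expo n u)) := by
    refine tsum_congr fun n => ?_
    unfold phiTerm; ring
  rw [tsum_mul_left, h2.tsum_sub h0] at h4
  linarith

lemma Phi_neg (u : ℝ) : Phi (-u) = Phi u := by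
  have h0 : (fun u => thetaSum (-u)) = thetaSum := funext thetaSum_neg
  have h1 : (fun u => deriv thetaSum (-u)) = fun u => -deriv thetaSum u := by
    funext u
    have := deriv_comp_neg thetaSum u
    rw [h0] at this
    linarith
  have h2 : deriv (deriv thetaSum) (-u) = deriv (deriv thetaSum) u := by
    have h := deriv_comp_neg (deriv thetaSum) u
    rw [h1, deriv.fun_neg] at h
    linarith
  have h3 := Phi_eq_thetaSum u
  have h4 := Phi_eq_thetaSum (-u)
  rw [h2, thetaSum_neg] at h4
  linarith

lemma continuous_Phi : Continuous Phi := by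
  rw [show Phi = fun u => ∑' n, phiTerm n u from funext Phi_eq_tsum, continuous_iff_continuousAt]
  intro u
  have hu : Set.Ioo (-(|u| + 1)) (|u| + 1) ∈ nhds u :=
    isOpen_Ioo.mem_nhds ⟨by linarith [neg_abs_le u], by linarith [le_abs_self u]⟩
  refine ContinuousOn.continuousAt (continuousOn_tsum (fun n => ?_)
    (summable_one_div_succ_sq.mul_left
      ((|0| + 2 * |-3| + 6 * |2|) * exp (|u| + 1) / (π * exp (-(4 * (|u| + 1)))))) fun n v hv => ?_) hu
  · unfold phiTerm expo; fun_prop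
  · refine le_trans (le_of_eq (congrArg _ ?_)) (quadratic_term_le (c₀ := 0) (c₁ := -3) (c₂ := 2) hv)
    unfold phiTerm; ring

lemma phiTerm_pos (n : ℕ) {u : ℝ} (hu : 0 ≤ u) : 0 < phiTerm n u := by
  have h1 : 3 / 2 < expo n u := by
    have h2 : (1 : ℝ) ≤ ((n : ℝ) + 1) ^ 2 := one_le_pow₀ (by linarith [Nat.cast_nonneg (α := ℝ) n])
    have h3 : 1 ≤ exp (4 * u) := one_le_exp (by linarith)
    have h4 := pi_gt_three
    have h5 : 3 * 1 * 1 ≤ expo n u := by unfold expo; gcongr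
    linarith
  unfold phiTerm
  have : 0 < 2 * expo n u ^ 2 - 3 * expo n u := by nlinarith
  positivity

lemma Phi_pos {u : ℝ} (hu : 0 ≤ u) : 0 < Phi u := by
  rw [Phi_eq_tsum]
  exact (summable_phiTerm u).tsum_pos (fun n => (phiTerm_pos n hu).le) 0 (phiTerm_pos 0 hu)

lemma phiTerm_le (n : ℕ) {u : ℝ} (hu : 0 ≤ u) :
    phiTerm n u ≤ 32 * exp u * exp (-(exp (4 * u) / 2)) * (1 / ((n : ℝ) + 1) ^ 2) := by
  set N : ℝ := ((n : ℝ) + 1) ^ 2 with hN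
  have hN1 : 1 ≤ N := one_le_pow₀ (by linarith [Nat.cast_nonneg (α := ℝ) n])
  set E : ℝ := exp (4 * u) with hE
  have hE1 : 1 ≤ E := one_le_exp (by linarith)
  set a : ℝ := expo n u with ha
  have ha0 : 0 < a := expo_pos n u
  -- This splits exp(-a) in three: exp(-a/2) absorbs a², exp(-E/2) gives the decay in u, exp(-N/2)
  -- the summability in n.
  have haNE : N + E ≤ a := by
    have h1 : 3 * N * E ≤ a := by
      rw [ha, expo]; gcongr; exact pi_gt_three.le
    nlinarith
  have h1 : exp (-a) ≤ exp (-(a / 2)) * (exp (-(E / 2)) * exp (-(N / 2))) := by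
    rw [← exp_add, ← exp_add]; exact exp_le_exp.2 (by linarith)
  have h2 : 2 * a ^ 2 * exp (-(a / 2)) ≤ 16 := by
    have := pow_div_factorial_le_exp (a / 2) (by positivity) 2
    simp [Nat.factorial] at this
    rw [exp_neg, ← div_eq_mul_inv, div_le_iff₀ (exp_pos _)]
    linarith
  have h3 : exp (-(N / 2)) ≤ 2 * (1 / N) := by
    have := add_one_le_exp (N / 2)
    rw [exp_neg, ← one_div, mul_one_div, div_le_div_iff₀ (exp_pos _) (by positivity)]
    linarith
  calc phiTerm n u ≤ 2 * a ^ 2 * exp u * exp (-a) := by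
        unfold phiTerm; gcongr; linarith
    _ ≤ 2 * a ^ 2 * exp u * (exp (-(a / 2)) * (exp (-(E / 2)) * exp (-(N / 2)))) := by gcongr
    _ = (2 * a ^ 2 * exp (-(a / 2))) * exp u * exp (-(E / 2)) * exp (-(N / 2)) := by ring
    _ ≤ 16 * exp u * exp (-(E / 2)) * (2 * (1 / N)) := by gcongr
    _ = _ := by ring

/-- `Φ` decays faster than every Gaussian. -/
lemma exists_Phi_mul_exp_sq_le (t : ℝ) :
    ∃ C, ∀ u, 0 ≤ u → Phi u * exp (t * u ^ 2) ≤ C * exp (-u) := by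
  set K : ℝ := ∑' n : ℕ, 1 / ((n : ℝ) + 1) ^ 2 with hK
  have hK0 : 0 ≤ K := tsum_nonneg fun n => by positivity
  -- B bounds t u² + 2u for u ≤ |t| + 2; beyond that u³ dominates.
  set B : ℝ := |t| * (|t| + 2) ^ 2 + 2 * (|t| + 2) with hB
  refine ⟨32 * K * exp B, fun u hu => ?_⟩
  have h1 : Phi u ≤ 32 * exp u * exp (-(exp (4 * u) / 2)) * K := by
    rw [Phi_eq_tsum, hK, ← tsum_mul_left]
    exact (summable_phiTerm u).tsum_le_tsum (fun n => phiTerm_le n hu)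
      (summable_one_div_succ_sq.mul_left _)
  have h2 : u ^ 3 ≤ exp (4 * u) / 2 := by
    have := pow_div_factorial_le_exp (4 * u) (by positivity) 3
    simp [Nat.factorial] at this
    have : 0 ≤ u ^ 3 := by positivity
    nlinarith
  have h3 : t * u ^ 2 + 2 * u ≤ B + u ^ 3 := by
    have h4 : t * u ^ 2 ≤ |t| * u ^ 2 := by gcongr; exact le_abs_self t
    have h5 := abs_nonneg t
    rcases le_total u (|t| + 2) with h | h
    · have h6 : |t| * u ^ 2 ≤ |t| * (|t| + 2) ^ 2 := by gcongr
      have : 0 ≤ u ^ 3 := by positivity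
      linarith
    · have h7 : |t| * u ^ 2 + 2 * u ≤ u ^ 3 := by
        have h8 : 2 * u ≤ 2 * u ^ 2 := by nlinarith
        have h9 : (|t| + 2) * u ^ 2 ≤ u * u ^ 2 := by gcongr
        linarith
      have : 0 ≤ B := by positivity
      linarith
  calc Phi u * exp (t * u ^ 2)
      ≤ 32 * exp u * exp (-(exp (4 * u) / 2)) * K * exp (t * u ^ 2) := by gcongr
    _ = 32 * K * exp (u - exp (4 * u) / 2 + t * u ^ 2) := by
      rw [exp_add, exp_sub, exp_neg]; ring
    _ ≤ 32 * K * exp (B + -u) :=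
      mul_le_mul_of_nonneg_left (exp_le_exp.2 (by linarith)) (by positivity)
    _ = _ := by rw [exp_add]; ring

end DeBruijnNewman

/-! ### Analytic properties of `H t` -/

namespace DeBruijnNewman
open Real MeasureTheory Set

lemma integrableOn_Phi_mul_exp_sq (t : ℝ) :
    IntegrableOn (fun u => Phi u * exp (t * u ^ 2)) (Ioi 0) := by
  obtain ⟨C, hC⟩ := exists_Phi_mul_exp_sq_le t
  have h1 : IntegrableOn (fun u : ℝ => C * exp (-u)) (Ioi 0) :=
    (integrableOn_exp_neg_Ioi 0).const_mul C
  refine Integrable.mono' h1 (by have := continuous_Phi; fun_prop) ?_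
  refine (ae_restrict_mem measurableSet_Ioi).mono fun u hu => ?_
  have hu : 0 ≤ u := le_of_lt hu
  rw [norm_of_nonneg (mul_nonneg (Phi_pos hu).le (exp_pos _).le)]
  exact hC u hu

lemma _root_.Complex.norm_cos_le_exp_norm (w : ℂ) : ‖Complex.cos w‖ ≤ exp ‖w‖ := by
  unfold Complex.cos
  rw [norm_div]
  have h1 := Complex.norm_exp_le_exp_norm (w * Complex.I)
  have h2 := Complex.norm_exp_le_exp_norm (-w * Complex.I)
  have h3 := norm_add_le (Complex.exp (w * Complex.I)) (Complex.exp (-w * Complex.I))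
  simp only [norm_mul, Complex.norm_I, mul_one, norm_neg] at h1 h2
  simp only [Complex.norm_ofNat]
  linarith

lemma _root_.Complex.norm_sin_le_exp_norm (w : ℂ) : ‖Complex.sin w‖ ≤ exp ‖w‖ := by
  unfold Complex.sin
  rw [norm_div, norm_mul, Complex.norm_I, mul_one]
  have h1 := Complex.norm_exp_le_exp_norm (w * Complex.I)
  have h2 := Complex.norm_exp_le_exp_norm (-w * Complex.I)
  have h3 := norm_sub_le (Complex.exp (-w * Complex.I)) (Complex.exp (w * Complex.I))
  simp only [norm_mul, Complex.norm_I, mul_one, norm_neg] at h1 h2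
  simp only [Complex.norm_ofNat]
  linarith

/-- From |z|u ≤ c|z|² + u²/(4c). As Φ absorbs any Gaussian in u, c may be arbitrarily small, which
is the growth condition of `exists_polynomial_approx`. -/
lemma norm_cos_mul_le {c : ℝ} (hc : 0 < c) (z : ℂ) {u : ℝ} (hu : 0 ≤ u) :
    ‖Complex.cos (z * u)‖ ≤ exp (c * ‖z‖ ^ 2) * exp (1 / (4 * c) * u ^ 2) := by
  refine (Complex.norm_cos_le_exp_norm _).trans ?_
  rw [← exp_add, norm_mul, Complex.norm_real, norm_of_nonneg hu]
  refine exp_le_exp.2 ?_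
  have : c * ‖z‖ ^ 2 + 1 / (4 * c) * u ^ 2 - ‖z‖ * u = c * (‖z‖ - u / (2 * c)) ^ 2 := by
    field_simp; ring
  nlinarith [mul_nonneg hc.le (sq_nonneg (‖z‖ - u / (2 * c)))]

/-- A weight `w ≤ e^{tu²}` against `Φ(u) cos(zu)` is dominated by a Gaussian multiple of `Φ`. -/
lemma norm_weight_mul_cos_le {c t w : ℝ} (hc : 0 < c) (z : ℂ) {u : ℝ} (hu : 0 ≤ u)
    (hw : |w| ≤ exp (t * u ^ 2)) :
    ‖((w * Phi u : ℝ) : ℂ) * Complex.cos (z * u)‖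
      ≤ exp (c * ‖z‖ ^ 2) * (Phi u * exp ((t + 1 / (4 * c)) * u ^ 2)) := by
  rw [norm_mul, Complex.norm_real, norm_mul, norm_of_nonneg (Phi_pos hu).le, norm_eq_abs]
  have h1 := norm_cos_mul_le hc z hu
  have h2 := (Phi_pos hu).le
  calc _ ≤ exp (t * u ^ 2) * Phi u * (exp (c * ‖z‖ ^ 2) * exp (1 / (4 * c) * u ^ 2)) := by gcongr
    _ = _ := by rw [add_mul, exp_add]; ring

lemma integrableOn_weight_mul_cos {t : ℝ} {w : ℝ → ℝ} (hw : Continuous w)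
    (hwt : ∀ u, 0 ≤ u → |w u| ≤ exp (t * u ^ 2)) (z : ℂ) :
    IntegrableOn (fun u : ℝ => ((w u * Phi u : ℝ) : ℂ) * Complex.cos (z * u)) (Ioi 0) := by
  refine Integrable.mono' ((integrableOn_Phi_mul_exp_sq (t + 1 / (4 * 1))).const_mul
    (exp (1 * ‖z‖ ^ 2))) ?_ ?_
  · have := continuous_Phi
    exact (by fun_prop : Continuous fun u : ℝ => ((w u * Phi u : ℝ) : ℂ) * Complex.cos (z * u)).aestronglyMeasurable
  · exact (ae_restrict_mem measurableSet_Ioi).mono fun u hu =>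
      norm_weight_mul_cos_le one_pos z (le_of_lt hu) (hwt u (le_of_lt hu))

lemma H_neg (t : ℝ) (z : ℂ) : H t (-z) = H t z := by
  unfold H
  simp only [neg_mul, Complex.cos_neg]

open ComplexConjugate in
lemma H_conj (t : ℝ) (z : ℂ) : H t (conj z) = conj (H t z) := by
  unfold H
  rw [← integral_conj]
  congr 1; funext u
  rw [map_mul, Complex.conj_ofReal, ← Complex.cos_conj, map_mul, Complex.conj_ofReal]

lemma norm_H_le {c t T : ℝ} (hc : 0 < c) (ht : t ≤ T) (z : ℂ) :
    ‖H t z‖ ≤ (∫ u in Ioi (0 : ℝ), Phi u * exp ((T + 1 / (4 * c)) * u ^ 2)) * exp (c * ‖z‖ ^ 2) := by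
  rw [mul_comm, ← integral_const_mul]
  refine norm_integral_le_of_norm_le ((integrableOn_Phi_mul_exp_sq _).const_mul _) ?_
  refine (ae_restrict_mem measurableSet_Ioi).mono fun u hu =>
    norm_weight_mul_cos_le hc z (le_of_lt hu) ?_
  rw [abs_exp]; gcongr

lemma H_zero_ne_zero (t : ℝ) : H t 0 ≠ 0 := by
  have h : H t 0 = ((∫ u in Ioi (0 : ℝ), exp (t * u ^ 2) * Phi u : ℝ) : ℂ) := by
    unfold H
    refine Eq.trans ?_ integral_complex_ofReal
    simp
  rw [h, Complex.ofReal_ne_zero]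
  refine ne_of_gt ?_
  rw [setIntegral_pos_iff_support_of_nonneg_ae]
  · have : Function.support (fun u => exp (t * u ^ 2) * Phi u) ∩ Ioi 0 = Ioi 0 := by
      refine inter_eq_right.2 fun u hu => ?_
      exact (mul_pos (exp_pos _) (Phi_pos (le_of_lt hu))).ne'
    rw [this]; simp
  · refine (ae_restrict_mem measurableSet_Ioi).mono fun u hu => ?_
    exact (mul_pos (exp_pos _) (Phi_pos (le_of_lt hu))).le
  · simpa only [mul_comm] using integrableOn_Phi_mul_exp_sq t

lemma differentiable_H (t : ℝ) : Differentiable ℂ (H t) := by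
  intro z₀
  have hΦ := continuous_Phi
  have hd : ∀ u : ℝ, ∀ z : ℂ, HasDerivAt
      (fun z => ((exp (t * u ^ 2) * Phi u : ℝ) : ℂ) * Complex.cos (z * u))
      (((exp (t * u ^ 2) * Phi u : ℝ) : ℂ) * (-Complex.sin (z * u) * u)) z := by
    intro u z
    have := ((hasDerivAt_id z).mul_const (u : ℂ)).ccos.const_mul ((exp (t * u ^ 2) * Phi u : ℝ) : ℂ)
    simpa using this
  refine ((hasDerivAt_integral_of_dominated_loc_of_deriv_le (μ := volume.restrict (Ioi (0 : ℝ)))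
    (bound := fun u => exp ((‖z₀‖ + 2) ^ 2) * (Phi u * exp ((t + 1 / 4) * u ^ 2)))
    (F := fun z u => ((exp (t * u ^ 2) * Phi u : ℝ) : ℂ) * Complex.cos (z * (u : ℂ)))
    (F' := fun z u => ((exp (t * u ^ 2) * Phi u : ℝ) : ℂ) * (-Complex.sin (z * u) * u))
    (Metric.ball_mem_nhds z₀ one_pos) (Filter.Eventually.of_forall fun z => ?_)
    ?_ ?_ ?_ ?_ ?_).2).differentiableAt
  · exact (by fun_prop : Continuous fun u : ℝ =>
      ((exp (t * u ^ 2) * Phi u : ℝ) : ℂ) * Complex.cos (z * u)).aestronglyMeasurable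
  · exact integrableOn_weight_mul_cos (t := t) (by fun_prop) (fun u _ => by rw [abs_exp]) z₀
  · exact (by fun_prop : Continuous fun u : ℝ =>
      ((exp (t * u ^ 2) * Phi u : ℝ) : ℂ) * (-Complex.sin (z₀ * u) * u)).aestronglyMeasurable
  · refine (ae_restrict_mem measurableSet_Ioi).mono fun u hu z hz => ?_
    have hu : 0 ≤ u := le_of_lt hu
    have hz : ‖z‖ ≤ ‖z₀‖ + 1 := by
      have h1 := norm_sub_norm_le z z₀
      have h2 : ‖z - z₀‖ < 1 := by simpa [dist_eq_norm] using hz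
      linarith
    have h2 := (Phi_pos hu).le
    rw [norm_mul, Complex.norm_real, norm_mul (exp _), norm_of_nonneg h2, norm_mul, norm_neg,
      Complex.norm_real, norm_of_nonneg hu, norm_of_nonneg (exp_pos _).le]
    have h1 := Complex.norm_sin_le_exp_norm (z * u)
    rw [norm_mul, Complex.norm_real, norm_of_nonneg hu] at h1
    have h3 : u ≤ exp u := by linarith [add_one_le_exp u]
    calc _ ≤ exp (t * u ^ 2) * Phi u * (exp ((‖z₀‖ + 1) * u) * exp u) := by
          gcongr
          exact h1.trans (exp_le_exp.2 (by gcongr))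
      _ = Phi u * exp (t * u ^ 2 + (‖z₀‖ + 2) * u) := by
        rw [exp_add, show (‖z₀‖ + 2) * u = (‖z₀‖ + 1) * u + u by ring, exp_add]; ring
      _ ≤ Phi u * exp ((‖z₀‖ + 2) ^ 2 + (t + 1 / 4) * u ^ 2) :=
        mul_le_mul_of_nonneg_left
          (exp_le_exp.2 (by nlinarith [sq_nonneg (‖z₀‖ + 2 - u / 2)])) h2
      _ = _ := by rw [exp_add]; ring
  · exact (integrableOn_Phi_mul_exp_sq _).const_mul _
  · exact Filter.Eventually.of_forall fun u z _ => hd u z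

lemma continuous_H : Continuous fun p : ℝ × ℂ => H p.1 p.2 := by
  rw [continuous_iff_continuousAt]
  rintro ⟨t₀, z₀⟩
  have hΦ := continuous_Phi
  refine continuousAt_of_dominated (μ := volume.restrict (Ioi (0 : ℝ)))
    (bound := fun u => exp (1 * (‖z₀‖ + 1) ^ 2) * (Phi u * exp ((t₀ + 1 + 1 / (4 * 1)) * u ^ 2)))
    (Filter.Eventually.of_forall fun p => ?_) ?_ ((integrableOn_Phi_mul_exp_sq _).const_mul _)
    (Filter.Eventually.of_forall fun u => ?_)
  · exact (by fun_prop : Continuous fun u : ℝ =>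
      ((exp (p.1 * u ^ 2) * Phi u : ℝ) : ℂ) * Complex.cos (p.2 * u)).aestronglyMeasurable
  · have h1 : ∀ᶠ p : ℝ × ℂ in nhds (t₀, z₀), p.1 < t₀ + 1 :=
      continuous_fst.continuousAt.eventually_lt continuousAt_const (by simp)
    have h2 : ∀ᶠ p : ℝ × ℂ in nhds (t₀, z₀), ‖p.2‖ < ‖z₀‖ + 1 :=
      continuous_snd.norm.continuousAt.eventually_lt continuousAt_const (by simp)
    filter_upwards [h1, h2] with p hp1 hp2
    refine (ae_restrict_mem measurableSet_Ioi).mono fun u hu => ?_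
    have hu : 0 ≤ u := le_of_lt hu
    refine (norm_weight_mul_cos_le one_pos p.2 (t := t₀ + 1) hu ?_).trans ?_
    · rw [abs_exp]; gcongr
    · have := (Phi_pos hu).le
      gcongr
  · exact (by fun_prop : Continuous fun p : ℝ × ℂ =>
      ((exp (p.1 * u ^ 2) * Phi u : ℝ) : ℂ) * Complex.cos (p.2 * u)).continuousAt

end DeBruijnNewman

/-! ### Approximation of `H t` by iterated vertical means -/

namespace DeBruijnNewman
open Real MeasureTheory Set

lemma one_add_sq_div_two_le_cosh {x : ℝ} (hx : 0 ≤ x) : 1 + x ^ 2 / 2 ≤ cosh x := by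
  have h1 : x / 2 ≤ sinh (x / 2) := self_le_sinh_iff.2 (by positivity)
  have h2 := cosh_two_mul (x / 2)
  rw [mul_div_cancel₀ x two_ne_zero, cosh_sq] at h2
  nlinarith

/-- With h = x²/2, cosh x ≥ 1 + h and (1 - h)e^h ≤ 1 give e^h - cosh x ≤ h²e^h; telescoping the
powers costs a factor n. For x = εu and nε² bounded the error is O(ε²). -/
lemma exp_half_sq_pow_sub_cosh_pow_le {x : ℝ} (hx : 0 ≤ x) (n : ℕ) :
    exp (x ^ 2 / 2) ^ n - cosh x ^ n ≤ n * (x ^ 2 / 2) ^ 2 * exp (x ^ 2 / 2) ^ n := by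
  have hA := cosh_le_exp_half_sq x
  have hc := one_add_sq_div_two_le_cosh hx
  set h := x ^ 2 / 2 with hh
  have hh0 : 0 ≤ h := by positivity
  have hB : 0 ≤ cosh x := by linarith
  have hAB : exp h - cosh x ≤ h ^ 2 * exp h := by
    have h1 := add_one_le_exp (-h)
    have h2 : exp (-h) * exp h = 1 := by rw [← exp_add]; simp
    have h3 : (-h + 1) * exp h ≤ 1 :=
      (mul_le_mul_of_nonneg_right h1 (exp_pos h).le).trans h2.le
    have h4 : (1 + h) * ((-h + 1) * exp h) ≤ (1 + h) * 1 := by gcongr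
    nlinarith
  induction n with
  | zero => simp
  | succ n ih =>
    have h1 : cosh x ^ n ≤ exp h ^ n := by gcongr
    have h2 : cosh x ^ n * (exp h - cosh x) ≤ exp h ^ n * (h ^ 2 * exp h) :=
      mul_le_mul h1 hAB (by linarith) (by positivity)
    have h3 : exp h * (exp h ^ n - cosh x ^ n) ≤ exp h * (n * h ^ 2 * exp h ^ n) := by gcongr
    push_cast
    calc exp h ^ (n + 1) - cosh x ^ (n + 1)
        = exp h * (exp h ^ n - cosh x ^ n) + cosh x ^ n * (exp h - cosh x) := by ring
      _ ≤ exp h * (n * h ^ 2 * exp h ^ n) + exp h ^ n * (h ^ 2 * exp h) := add_le_add h3 h2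
      _ = _ := by ring

/-- The `n`-fold vertical mean of `H 0`. -/
noncomputable def coshH (ε : ℝ) (n : ℕ) (z : ℂ) : ℂ :=
  ∫ u in Ioi (0 : ℝ), ((cosh (ε * u) ^ n * Phi u : ℝ) : ℂ) * Complex.cos (z * (u : ℂ))

lemma coshH_zero (ε : ℝ) : coshH ε 0 = H 0 := by
  funext z; simp [coshH, H]

lemma cosh_pow_le (ε u : ℝ) (n : ℕ) : cosh (ε * u) ^ n ≤ exp (n * ε ^ 2 / 2 * u ^ 2) := by
  calc cosh (ε * u) ^ n ≤ exp ((ε * u) ^ 2 / 2) ^ n := by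
        gcongr
        exact cosh_le_exp_half_sq _
    _ = _ := by rw [← exp_nat_mul]; congr 1; ring

lemma integrableOn_coshH (ε : ℝ) (n : ℕ) (z : ℂ) :
    IntegrableOn (fun u : ℝ => ((cosh (ε * u) ^ n * Phi u : ℝ) : ℂ) * Complex.cos (z * u)) (Ioi 0) := by
  refine integrableOn_weight_mul_cos (t := n * ε ^ 2 / 2) (w := fun u => cosh (ε * u) ^ n) ?_ ?_ z
  · exact (continuous_cosh.comp (continuous_const.mul continuous_id)).pow n
  · intro u _
    rw [abs_of_nonneg (pow_nonneg (cosh_pos _).le n)]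
    exact cosh_pow_le ε u n

lemma coshH_succ (ε : ℝ) (n : ℕ) (z : ℂ) :
    coshH ε (n + 1) z
      = (coshH ε n (z + ε * Complex.I) + coshH ε n (z - ε * Complex.I)) / 2 := by
  unfold coshH
  rw [← integral_add (integrableOn_coshH ε n _) (integrableOn_coshH ε n _), ← integral_div]
  congr 1; funext u
  have h1 : (z + ε * Complex.I) * u = z * u + (ε * u : ℝ) * Complex.I := by push_cast; ring
  have h2 : (z - ε * Complex.I) * u = z * u - (ε * u : ℝ) * Complex.I := by push_cast; ring
  rw [h1, h2, Complex.cos_add, Complex.cos_sub, Complex.cos_mul_I, ← Complex.ofReal_cosh]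
  push_cast
  ring

lemma norm_coshH_sub_H_le {ε t₀ R : ℝ} {n : ℕ} (hε : 0 ≤ ε) (hn : n * ε ^ 2 / 2 ≤ t₀) {z : ℂ}
    (hz : ‖z‖ ≤ R) :
    ‖coshH ε n z - H (n * ε ^ 2 / 2) z‖
      ≤ ε ^ 2 * (t₀ * exp (R ^ 2) * ∫ u in Ioi (0 : ℝ), Phi u * exp ((t₀ + 1 + 1 / 4) * u ^ 2)) := by
  have hint := integrableOn_weight_mul_cos (t := n * ε ^ 2 / 2)
    (w := fun u => exp (n * ε ^ 2 / 2 * u ^ 2)) (by fun_prop) (fun u _ => by rw [abs_exp]) z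
  unfold coshH H
  rw [← integral_sub (integrableOn_coshH ε n z) hint, ← mul_assoc, ← integral_const_mul]
  refine norm_integral_le_of_norm_le ((integrableOn_Phi_mul_exp_sq _).const_mul _) ?_
  refine (ae_restrict_mem measurableSet_Ioi).mono fun u hu => ?_
  have hu : 0 ≤ u := le_of_lt hu
  have hΦ := (Phi_pos hu).le
  have h1 := exp_half_sq_pow_sub_cosh_pow_le (mul_nonneg hε hu) n
  have he : exp ((ε * u) ^ 2 / 2) ^ n = exp (n * ε ^ 2 / 2 * u ^ 2) := by
    rw [← exp_nat_mul]; congr 1; ring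
  rw [he] at h1
  have h2 := cosh_pow_le ε u n
  have ht₀ : 0 ≤ t₀ := le_trans (by positivity) hn
  have h3 : u ^ 4 ≤ 2 * exp (u ^ 2) := by
    have := pow_div_factorial_le_exp (u ^ 2) (by positivity) 2
    simp [Nat.factorial] at this
    rw [← pow_mul] at this
    linarith
  have h4 : |exp (n * ε ^ 2 / 2 * u ^ 2) - cosh (ε * u) ^ n|
      ≤ ε ^ 2 * t₀ * exp ((t₀ + 1) * u ^ 2) := by
    rw [abs_of_nonneg (by linarith)]
    calc _ ≤ n * ((ε * u) ^ 2 / 2) ^ 2 * exp (n * ε ^ 2 / 2 * u ^ 2) := h1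
      _ = (n * ε ^ 2 / 2) * ε ^ 2 / 2 * u ^ 4 * exp (n * ε ^ 2 / 2 * u ^ 2) := by ring
      _ ≤ t₀ * ε ^ 2 / 2 * (2 * exp (u ^ 2)) * exp (t₀ * u ^ 2) := by gcongr
      _ = _ := by rw [add_mul, exp_add, one_mul]; ring
  have h5 := norm_cos_mul_le one_pos z hu
  rw [← sub_mul, norm_mul, norm_sub_rev, ← Complex.ofReal_sub, ← sub_mul, Complex.norm_real, norm_mul,
    norm_of_nonneg hΦ, norm_eq_abs]
  calc _ ≤ ε ^ 2 * t₀ * exp ((t₀ + 1) * u ^ 2) * Phi u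
        * (exp (1 * R ^ 2) * exp (1 / (4 * 1) * u ^ 2)) := by
        gcongr
        exact h5.trans (by gcongr)
    _ = _ := by
      rw [add_mul _ (1 / 4 : ℝ), exp_add, one_mul, mul_one]; ring

open Polynomial in
-- Averaging does not enlarge the error; each step only costs ε in the radius of validity.
lemma norm_eval_iterate_verticalMean_sub_coshH_le {P : ℂ[X]} {ε R η : ℝ} (hε : 0 ≤ ε) (n : ℕ)
    (h : ∀ z, ‖z‖ ≤ R + n * ε → ‖P.eval z - H 0 z‖ ≤ η) :
    ∀ z, ‖z‖ ≤ R → ‖((verticalMean ε)^[n] P).eval z - coshH ε n z‖ ≤ η := by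
  induction n generalizing R with
  | zero => simpa [coshH_zero] using h
  | succ n ih =>
    intro z hz
    have ih := ih (R := R + ε) fun w hw => h w (by push_cast; linarith)
    have hεI : ‖(ε * Complex.I : ℂ)‖ = ε := by simp [abs_of_nonneg hε]
    have h1 := ih (z + ε * Complex.I) ((norm_add_le _ _).trans (by linarith))
    have h2 := ih (z - ε * Complex.I) ((norm_sub_le _ _).trans (by linarith))
    rw [Function.iterate_succ_apply', eval_verticalMean, coshH_succ, ← sub_div, add_sub_add_comm,
      norm_div, Complex.norm_ofNat]
    have h3 := norm_add_le (((verticalMean ε)^[n] P).eval (z + ε * Complex.I) - coshH ε n (z + ε * Complex.I))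
      (((verticalMean ε)^[n] P).eval (z - ε * Complex.I) - coshH ε n (z - ε * Complex.I))
    linarith

open Polynomial ComplexConjugate in
/-- The family `H t`, `0 ≤ t ≤ t₀`, is approximated by the iterated vertical means of a real
polynomial whose zeros are zeros of `H 0`. -/
lemma exists_polynomial_approx_H {t₀ R η : ℝ} (ht₀ : 0 < t₀) (hR : 0 < R) (hη : 0 < η) :
    ∃ (N : ℕ) (ε : ℝ) (P : ℂ[X]), 0 < ε ∧ N * ε ^ 2 = 2 * t₀ ∧ P ≠ 0 ∧
      (∀ z, P.eval (conj z) = conj (P.eval z)) ∧ (∀ z, P.eval z = 0 → H 0 z = 0) ∧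
      ∀ n ≤ N, ∀ z, ‖z‖ ≤ R →
        ‖((verticalMean ε)^[n] P).eval z - H (n * ε ^ 2 / 2) z‖ ≤ η := by
  set D := t₀ * exp (R ^ 2) * ∫ u in Ioi (0 : ℝ), Phi u * exp ((t₀ + 1 + 1 / 4) * u ^ 2) with hD
  -- With ε² = 2t₀/N this makes ε²D ≤ η/2, half of the allowed error; the polynomial gets the other
  -- half.
  obtain ⟨N, hN⟩ := exists_nat_gt (4 * t₀ * |D| / η)
  have hN0 : 0 < (N : ℝ) := lt_of_le_of_lt (by positivity) hN
  set ε := √(2 * t₀ / N) with hε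
  have hε0 : 0 < ε := sqrt_pos.2 (by positivity)
  have hε2 : ε ^ 2 = 2 * t₀ / N := sq_sqrt (by positivity)
  have hNε : N * ε ^ 2 = 2 * t₀ := by rw [hε2]; field_simp
  have hεD : ε ^ 2 * D ≤ η / 2 := by
    have h1 : ε ^ 2 * D ≤ ε ^ 2 * |D| := by gcongr; exact le_abs_self D
    refine h1.trans ?_
    rw [hε2, div_mul_eq_mul_div, div_le_iff₀ hN0]
    rw [div_lt_iff₀ hη] at hN
    linarith
  obtain ⟨P, hP0, hPc, hPz, hPa⟩ := exists_polynomial_approx (differentiable_H 0) (H_zero_ne_zero 0)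
    (H_neg 0) (H_conj 0) (fun c hc => ⟨_, fun z => norm_H_le hc le_rfl z⟩)
    (R := R + N * ε) (η := η / 2) (by positivity) (by positivity)
  refine ⟨N, ε, P, hε0, hNε, hP0, hPc, hPz, fun n hn z hz => ?_⟩
  have hnN : (n : ℝ) ≤ N := by exact_mod_cast hn
  have h1 := norm_eval_iterate_verticalMean_sub_coshH_le hε0.le n
    (fun w hw => hPa w (hw.trans (by gcongr))) z hz
  have h2 := norm_coshH_sub_H_le (n := n) (t₀ := t₀) hε0.le (by nlinarith [sq_nonneg ε]) hz
  calc _ ≤ _ := norm_sub_le_norm_sub_add_norm_sub _ (coshH ε n z) _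
    _ ≤ η := by linarith

end DeBruijnNewman

/-! ### Zeros of `H 0` lie in |Im z| ≤ 1 -/

namespace DeBruijnNewman
open Real MeasureTheory Set

/-- The integrand of the Gamma integral after the substitution `t = e^{4u}`. -/
noncomputable def gammaKernel (c : ℝ) (b : ℂ) (u : ℝ) : ℂ :=
  Complex.exp (4 * b * u) * (exp (-(c * exp (4 * u))) : ℝ)

lemma integral_gammaKernel {c : ℝ} (hc : 0 < c) {b : ℂ} (hb : 0 < b.re) :
    ∫ u, gammaKernel c b u = 1 / 4 * ((1 / c : ℝ) : ℂ) ^ b * Complex.Gamma b := by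
  have hder : ∀ u ∈ (univ : Set ℝ),
      HasDerivWithinAt (fun u : ℝ => exp (4 * u)) (4 * exp (4 * u)) univ u := by
    intro u _
    have := ((hasDerivAt_id u).const_mul 4).exp
    exact (this.congr_deriv (by simp; ring)).hasDerivWithinAt
  have hinj : InjOn (fun u : ℝ => exp (4 * u)) univ := by
    intro x _ y _ h
    have := exp_injective h
    linarith
  have himg : (fun u : ℝ => exp (4 * u)) '' univ = Ioi 0 := by
    ext t
    simp only [image_univ, mem_range, mem_Ioi]
    refine ⟨?_, fun ht => ⟨log t / 4, ?_⟩⟩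
    · rintro ⟨u, rfl⟩; exact exp_pos _
    · rw [mul_div_cancel₀ _ four_ne_zero, exp_log ht]
  have h := integral_image_eq_integral_abs_deriv_smul MeasurableSet.univ hder hinj
    (fun t : ℝ => (t : ℂ) ^ (b - 1) * Complex.exp (-(c * t)))
  rw [himg, Complex.integral_cpow_mul_exp_neg_mul_Ioi hb hc, Measure.restrict_univ] at h
  have h2 : ∀ u : ℝ, |4 * exp (4 * u)| • (((exp (4 * u) : ℝ) : ℂ) ^ (b - 1)
      * Complex.exp (-(c * (exp (4 * u) : ℝ)))) = 4 * gammaKernel c b u := by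
    intro u
    rw [abs_of_pos (by positivity), Complex.cpow_def_of_ne_zero (by simp),
      ← Complex.ofReal_log (exp_pos _).le, log_exp, gammaKernel, Complex.real_smul]
    push_cast
    have : Complex.exp (4 * u) * Complex.exp (4 * u * (b - 1)) = Complex.exp (4 * b * u) := by
      rw [← Complex.exp_add]; congr 1; ring
    rw [← this]; ring
  simp only [h2] at h
  rw [integral_const_mul] at h
  push_cast
  linear_combination -h / 4

lemma integral_gammaKernel_ne_zero {c : ℝ} (hc : 0 < c) {b : ℂ} (hb : 0 < b.re) :
    ∫ u, gammaKernel c b u ≠ 0 := by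
  rw [integral_gammaKernel hc hb]
  refine mul_ne_zero (mul_ne_zero (by norm_num) ?_) (Complex.Gamma_ne_zero_of_re_pos hb)
  simp [Complex.cpow_eq_zero_iff, hc.ne']

/-- The integral of a non-integrable function is 0 by convention, so the nonzero Gamma value
certifies integrability. -/
lemma integrable_gammaKernel {c : ℝ} (hc : 0 < c) {b : ℂ} (hb : 0 < b.re) :
    Integrable (gammaKernel c b) :=
  .of_integral_ne_zero (integral_gammaKernel_ne_zero hc hb)

lemma integral_norm_gammaKernel {c : ℝ} (hc : 0 < c) {b : ℂ} (hb : 0 < b.re) :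
    ∫ u, ‖gammaKernel c b u‖ = 1 / 4 * (1 / c) ^ b.re * ‖Complex.Gamma b.re‖ := by
  have h1 : ∀ u, gammaKernel c b.re u = ((‖gammaKernel c b u‖ : ℝ) : ℂ) := by
    intro u
    rw [gammaKernel, gammaKernel, norm_mul, Complex.norm_exp, Complex.norm_real,
      norm_of_nonneg (exp_pos _).le]
    push_cast
    simp
  have h2 := integral_gammaKernel hc (b := (b.re : ℂ)) (by simpa using hb)
  simp only [h1] at h2
  rw [integral_complex_ofReal] at h2
  have h3 := congrArg norm h2
  rw [Complex.norm_real, norm_of_nonneg (integral_nonneg fun _ => norm_nonneg _), norm_mul, norm_mul,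
    Complex.norm_cpow_eq_rpow_re_of_pos (by positivity)] at h3
  simpa using h3

lemma phiTerm_mul_exp (n : ℕ) (u : ℝ) (b : ℂ) :
    (phiTerm n u : ℂ) * Complex.exp ((4 * b - 1) * u)
      = 2 * (π * ((n : ℝ) + 1) ^ 2 : ℝ) ^ 2 * gammaKernel (π * ((n : ℝ) + 1) ^ 2) (b + 2) u
        - 3 * (π * ((n : ℝ) + 1) ^ 2 : ℝ) * gammaKernel (π * ((n : ℝ) + 1) ^ 2) (b + 1) u := by
  have h1 : Complex.exp (4 * (b + 2) * u)
      = Complex.exp (4 * u) ^ 2 * Complex.exp u * Complex.exp ((4 * b - 1) * u) := by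
    rw [← Complex.exp_nat_mul, ← Complex.exp_add, ← Complex.exp_add]; congr 1; push_cast; ring
  have h2 : Complex.exp (4 * (b + 1) * u)
      = Complex.exp (4 * u) * Complex.exp u * Complex.exp ((4 * b - 1) * u) := by
    rw [← Complex.exp_add, ← Complex.exp_add]; congr 1; ring
  unfold phiTerm gammaKernel expo
  rw [h1, h2]
  push_cast
  ring

/-- The two Gamma integrals combine through 2Γ(b+2) - 3Γ(b+1) = b(2b - 1)Γ(b). -/
lemma integral_phiTerm_mul_exp (n : ℕ) {b : ℂ} (hb : 0 < b.re) :
    ∫ u : ℝ, (phiTerm n u : ℂ) * Complex.exp ((4 * b - 1) * u)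
      = 1 / 4 * (π : ℂ) ^ (-b) * Complex.Gamma b * b * (2 * b - 1) * (1 / ((n : ℂ) + 1) ^ (2 * b)) := by
  have hN : 0 < (n : ℝ) + 1 := by positivity
  have hc : 0 < π * ((n : ℝ) + 1) ^ 2 := by positivity
  have hb1 : 0 < (b + 1).re := by simp; linarith
  have hb2 : 0 < (b + 2).re := by simp; linarith
  have hb0 : b ≠ 0 := by rintro rfl; simp at hb
  have hb0' : b + 1 ≠ 0 := by intro h; rw [h] at hb1; simp at hb1
  simp only [phiTerm_mul_exp]
  rw [integral_sub ((integrable_gammaKernel hc hb2).const_mul _)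
    ((integrable_gammaKernel hc hb1).const_mul _), integral_const_mul, integral_const_mul,
    integral_gammaKernel hc hb2, integral_gammaKernel hc hb1]
  have hG2 : Complex.Gamma (b + 2) = (b + 1) * b * Complex.Gamma b := by
    rw [show b + 2 = b + 1 + 1 by ring, Complex.Gamma_add_one _ hb0', Complex.Gamma_add_one _ hb0]; ring
  have hpow : ((1 / (π * ((n : ℝ) + 1) ^ 2) : ℝ) : ℂ) ^ b
      = (π : ℂ) ^ (-b) * (1 / ((n : ℂ) + 1) ^ (2 * b)) := by
    have h1 : ((n : ℂ) + 1) = (((n : ℝ) + 1 : ℝ) : ℂ) := by push_cast; rfl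
    have h0 : ((1 / (π * ((n : ℝ) + 1) ^ 2) : ℝ) : ℂ) ≠ 0 :=
      Complex.ofReal_ne_zero.2 (by positivity)
    rw [h1, Complex.cpow_def_of_ne_zero h0,
      Complex.cpow_def_of_ne_zero (Complex.ofReal_ne_zero.2 pi_ne_zero),
      Complex.cpow_def_of_ne_zero (Complex.ofReal_ne_zero.2 hN.ne'), one_div (Complex.exp _),
      ← Complex.exp_neg, ← Complex.exp_add, ← Complex.ofReal_log (by positivity),
      ← Complex.ofReal_log pi_pos.le, ← Complex.ofReal_log hN.le, one_div, log_inv,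
      log_mul pi_ne_zero (by positivity), log_pow]
    congr 1
    push_cast
    ring
  have hc0 : ((1 / (π * ((n : ℝ) + 1) ^ 2) : ℝ) : ℂ) ≠ 0 :=
    Complex.ofReal_ne_zero.2 (by positivity)
  have hp1 : ((1 / (π * ((n : ℝ) + 1) ^ 2) : ℝ) : ℂ) ^ (b + 1)
      = (π : ℂ) ^ (-b) * (1 / ((n : ℂ) + 1) ^ (2 * b)) / (π * ((n : ℝ) + 1) ^ 2 : ℝ) := by
    rw [Complex.cpow_add _ _ hc0, hpow, Complex.cpow_one]
    push_cast; ring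
  have hp2 : ((1 / (π * ((n : ℝ) + 1) ^ 2) : ℝ) : ℂ) ^ (b + 2)
      = (π : ℂ) ^ (-b) * (1 / ((n : ℂ) + 1) ^ (2 * b)) / (π * ((n : ℝ) + 1) ^ 2 : ℝ) ^ 2 := by
    rw [Complex.cpow_add _ _ hc0, hpow, Complex.cpow_ofNat]
    push_cast
    rw [one_div_pow, mul_one_div]
  have hcc : ((π * ((n : ℝ) + 1) ^ 2 : ℝ) : ℂ) ≠ 0 := Complex.ofReal_ne_zero.2 hc.ne'
  rw [hp1, hp2, hG2, Complex.Gamma_add_one _ hb0]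
  field_simp
  ring

lemma summable_integral_norm_phiTerm {b : ℂ} (hb : 1 / 2 < b.re) :
    Summable fun n : ℕ => ∫ u : ℝ, ‖(phiTerm n u : ℂ) * Complex.exp ((4 * b - 1) * u)‖ := by
  have hb1 : 0 < (b + 1).re := by simp; linarith
  have hb2 : 0 < (b + 2).re := by simp; linarith
  have hs : Summable fun n : ℕ => (1 / (π * ((n : ℝ) + 1) ^ 2)) ^ b.re := by
    have h := ((summable_nat_add_iff 1).2 (Real.summable_one_div_nat_rpow (p := 2 * b.re)|>.2
      (by linarith))).mul_left ((1 / π) ^ b.re)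
    refine h.congr fun n => ?_
    have hN : 0 ≤ (n : ℝ) + 1 := by positivity
    rw [← one_div_mul_one_div, mul_rpow (by positivity) (by positivity), one_div (_ ^ 2),
      inv_rpow (by positivity), ← rpow_natCast, ← rpow_mul hN, one_div (_ ^ (2 * b.re))]
    push_cast
    rfl
  set K := 2 * (1 / 4 * ‖Complex.Gamma ((b + 2).re : ℝ)‖) + 3 * (1 / 4 * ‖Complex.Gamma ((b + 1).re : ℝ)‖) with hK
  refine Summable.of_nonneg_of_le (fun n => integral_nonneg fun _ => norm_nonneg _) (fun n => ?_)
    (hs.mul_left K)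
  set c := π * ((n : ℝ) + 1) ^ 2 with hc'
  have hc : 0 < c := by positivity
  have hi2 := integrable_gammaKernel hc hb2
  have hi1 := integrable_gammaKernel hc hb1
  simp only [phiTerm_mul_exp]
  calc _ ≤ ∫ u, (2 * c ^ 2 * ‖gammaKernel c (b + 2) u‖ + 3 * c * ‖gammaKernel c (b + 1) u‖) := by
        refine integral_mono ((hi2.const_mul _).sub (hi1.const_mul _)).norm
          ((hi2.norm.const_mul _).add (hi1.norm.const_mul _)) fun u => ?_
        refine (norm_sub_le _ _).trans (le_of_eq ?_)
        simp only [norm_mul, norm_pow, Complex.norm_real, Complex.norm_ofNat, norm_of_nonneg hc.le, ← hc']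
    _ = 2 * c ^ 2 * (1 / 4 * (1 / c) ^ (b + 2).re * ‖Complex.Gamma ((b + 2).re : ℝ)‖)
        + 3 * c * (1 / 4 * (1 / c) ^ (b + 1).re * ‖Complex.Gamma ((b + 1).re : ℝ)‖) := by
      rw [integral_add (hi2.norm.const_mul _) (hi1.norm.const_mul _), integral_const_mul,
        integral_const_mul, integral_norm_gammaKernel hc hb2, integral_norm_gammaKernel hc hb1]
    _ = K * (1 / c) ^ b.re := by
      have hc1 : 0 < 1 / c := by positivity
      rw [Complex.add_re, Complex.add_re, rpow_add hc1, rpow_add hc1, hK]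
      simp only [Complex.re_ofNat, Complex.one_re, rpow_one, rpow_ofNat, Complex.add_re]
      field_simp
    _ ≤ _ := le_rfl

lemma H_zero_eq_integral {z : ℂ} (h : ∫ u : ℝ, (Phi u : ℂ) * Complex.exp (Complex.I * z * u) ≠ 0) :
    ∫ u : ℝ, (Phi u : ℂ) * Complex.exp (Complex.I * z * u) = 2 * H 0 z := by
  set f : ℝ → ℂ := fun u => (Phi u : ℂ) * Complex.exp (Complex.I * z * u) with hf
  have hint : Integrable f := .of_integral_ne_zero h
  rw [← intervalIntegral.integral_Iic_add_Ioi (b := 0) hint.integrableOn hint.integrableOn]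
  have h1 := integral_comp_neg_Ioi 0 f
  rw [neg_zero] at h1
  rw [← h1, ← integral_add hint.comp_neg.integrableOn hint.integrableOn, H, ← integral_const_mul]
  congr 1; funext u
  simp only [hf, Phi_neg, zero_mul, exp_zero, one_mul, Complex.cos]
  push_cast
  rw [show Complex.I * z * -(u : ℂ) = -(z * u) * Complex.I by ring,
    show Complex.I * z * (u : ℂ) = z * u * Complex.I by ring]
  ring

/-- With b = (1 + iz)/4, summing over n gives 2 `H 0 z` = ¼ π^{-b} Γ(b) b(2b - 1) ζ(2b), and Im z <
-1 means Re 2b > 1, where no factor vanishes. -/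
lemma H_zero_ne_zero_of_im_lt {z : ℂ} (hz : z.im < -1) : H 0 z ≠ 0 := by
  set b : ℂ := (1 + Complex.I * z) / 4 with hb
  have hbre : 1 / 2 < b.re := by
    have : b.re = (1 - z.im) / 4 := by
      rw [hb, Complex.div_ofNat_re]; simp; ring
    rw [this]; linarith
  have hb0 : 0 < b.re := by linarith
  have hint : ∀ n : ℕ, Integrable fun u : ℝ => (phiTerm n u : ℂ) * Complex.exp ((4 * b - 1) * u) := by
    intro n
    have hc : 0 < π * ((n : ℝ) + 1) ^ 2 := by positivity
    simp only [phiTerm_mul_exp]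
    exact ((integrable_gammaKernel hc (by simp; linarith)).const_mul _).sub
      ((integrable_gammaKernel hc (by simp; linarith)).const_mul _)
  have hsum := (hasSum_integral_of_summable_integral_norm hint
    (summable_integral_norm_phiTerm hbre)).tsum_eq
  simp only [integral_phiTerm_mul_exp _ hb0] at hsum
  rw [tsum_mul_left, ← zeta_eq_tsum_one_div_nat_add_one_cpow (by simp; linarith)] at hsum
  have hPhi : ∀ u : ℝ, ∑' n, (phiTerm n u : ℂ) * Complex.exp ((4 * b - 1) * u)
      = (Phi u : ℂ) * Complex.exp (Complex.I * z * u) := by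
    intro u
    rw [tsum_mul_right, Phi_eq_tsum, Complex.ofReal_tsum, hb]
    congr 3; ring
  simp only [hPhi] at hsum
  have hne : ∫ u : ℝ, (Phi u : ℂ) * Complex.exp (Complex.I * z * u) ≠ 0 := by
    rw [← hsum]
    have h1 : b ≠ 0 := by intro h; rw [h] at hb0; simp at hb0
    have h2 : 2 * b - 1 ≠ 0 := by
      intro h
      have := congrArg Complex.re h
      simp at this; linarith
    have h3 : (π : ℂ) ^ (-b) ≠ 0 := by simp [Complex.cpow_eq_zero_iff, pi_ne_zero]
    have h4 := Complex.Gamma_ne_zero_of_re_pos hb0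
    have h5 : riemannZeta (2 * b) ≠ 0 := riemannZeta_ne_zero_of_one_lt_re (by simp; linarith)
    have h6 : (1 / 4 : ℂ) ≠ 0 := by norm_num
    exact mul_ne_zero (mul_ne_zero (mul_ne_zero (mul_ne_zero (mul_ne_zero h6 h3) h4) h1) h2) h5
  intro h
  exact hne (by rw [H_zero_eq_integral hne, h, mul_zero])

/-- The zeros of `H 0` lie in the strip `|Im z| ≤ 1`. -/
lemma im_sq_le_one_of_H_zero_eq_zero {z : ℂ} (hz : H 0 z = 0) : z.im ^ 2 ≤ 1 := by
  by_contra! h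
  rcases lt_or_gt_of_ne (show z.im ≠ 0 by rintro h0; rw [h0] at h; norm_num at h) with h0 | h0
  · exact H_zero_ne_zero_of_im_lt (by nlinarith) hz
  · refine H_zero_ne_zero_of_im_lt (z := -z) ?_ (by rw [H_neg, hz])
    rw [Complex.neg_im]; nlinarith

end DeBruijnNewman

/-! ### Hurwitz's theorem, the barrier and the conclusion -/

open Metric Set in
/-- Hurwitz's theorem: entire functions close to `F` have a zero close to each zero of `F`. -/
lemma exists_zero_of_close {F : ℂ → ℂ} (hF : Differentiable ℂ F) {a : ℂ} (ha : F a ≠ 0) {z₀ : ℂ}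
    (hz₀ : F z₀ = 0) {r : ℝ} (hr : 0 < r) :
    ∃ η : ℝ, 0 < η ∧ ∀ G : ℂ → ℂ, Differentiable ℂ G →
      (∀ z ∈ closedBall z₀ r, ‖G z - F z‖ ≤ η) → ∃ w ∈ closedBall z₀ r, G w = 0 := by
  have hne : ∀ᶠ z in nhdsWithin z₀ {z₀}ᶜ, F z ≠ 0 := by
    rcases (hF.analyticAt z₀).eventually_eq_zero_or_eventually_ne_zero with h | h
    · exact absurd (analyticOrderAt_eq_top.2 h) (hF.analyticOrderAt_ne_top ha z₀)
    · exact h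
  rw [eventually_nhdsWithin_iff] at hne
  obtain ⟨δ, hδ, hball⟩ := Metric.eventually_nhds_iff.1 hne
  set s := min r (δ / 2) with hs
  have hs0 : 0 < s := by positivity
  obtain ⟨m, hm, hmF⟩ := (isCompact_sphere z₀ s).exists_forall_le' (f := fun z => ‖F z‖) (a := 0)
    hF.continuous.norm.continuousOn (by
      intro z hz
      have hzs : dist z z₀ = s := hz
      refine norm_pos_iff.2 (hball ?_ ?_)
      · rw [hzs]; linarith [min_le_right r (δ / 2)]
      · rintro rfl; rw [dist_self] at hzs; exact hs0.ne hzs)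
  -- A zero-free G would satisfy |G| ≥ 3m/4 on the sphere, hence at z₀ by the maximum principle for
  -- 1/G, against |G z₀| ≤ m/4.
  refine ⟨m / 4, by positivity, fun G hG hGF => ?_⟩
  by_contra! hGne
  have hsub : closedBall z₀ s ⊆ closedBall z₀ r := closedBall_subset_closedBall (min_le_left _ _)
  have hd : DifferentiableOn ℂ (fun z => (G z)⁻¹) (closedBall z₀ s) :=
    hG.differentiableOn.fun_inv fun z hz => hGne z (hsub hz)
  have hcl : DiffContOnCl ℂ (fun z => (G z)⁻¹) (ball z₀ s) := by
    refine DifferentiableOn.diffContOnCl ?_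
    rwa [closure_ball _ hs0.ne']
  have hmax : ‖(G z₀)⁻¹‖ ≤ (3 * m / 4)⁻¹ := by
    refine Complex.norm_le_of_forall_mem_frontier_norm_le isBounded_ball hcl ?_
      (subset_closure (mem_ball_self hs0))
    intro w hw
    rw [frontier_ball _ hs0.ne'] at hw
    have h1 := hmF w hw
    have h2 := hGF w (hsub (sphere_subset_closedBall hw))
    have h3 := norm_sub_norm_le (F w) (G w)
    rw [norm_sub_rev] at h3
    rw [norm_inv]
    exact inv_anti₀ (by positivity) (by linarith)
  have hz := hGF z₀ (mem_closedBall_self hr.le)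
  have hG0 : G z₀ ≠ 0 := hGne z₀ (mem_closedBall_self hr.le)
  rw [norm_inv, inv_le_inv₀ (norm_pos_iff.2 hG0) (by positivity)] at hmax
  rw [hz₀, sub_zero] at hz
  linarith

namespace DeBruijnNewman
open Real Set

lemma norm_H_abs (t : ℝ) (z : ℂ) : ‖H t ((|z.re| : ℝ) + (|z.im| : ℝ) * Complex.I)‖ = ‖H t z‖ := by
  have hc : ∀ w : ℂ, ‖H t ⟨w.re, -w.im⟩‖ = ‖H t w‖ := by
    intro w
    rw [← RCLike.norm_conj (H t w), ← H_conj]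
    congr 1
  have hn : ∀ w : ℂ, ‖H t ⟨-w.re, -w.im⟩‖ = ‖H t w‖ := by
    intro w
    rw [← H_neg t w]
    congr 1
  have he : ((|z.re| : ℝ) + (|z.im| : ℝ) * Complex.I : ℂ) = ⟨|z.re|, |z.im|⟩ := by
    apply Complex.ext <;> simp
  rw [he]
  rcases abs_choice z.re with h1 | h1 <;> rcases abs_choice z.im with h2 | h2 <;> rw [h1, h2]
  · exact hc z
  · rw [← hc z, ← hn ⟨z.re, -z.im⟩, neg_neg]
  · exact hn z

/-- De Bruijn's theorem: the zeros of `H t` satisfy `(Im z)² ≤ 1 - 2t` or are real. -/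
lemma H_ne_zero_of_lt_im_sq {t₀ : ℝ} (ht₀ : 0 < t₀) {z : ℂ} (hz : 0 < z.im)
    (hz' : 1 - 2 * t₀ < z.im ^ 2) : H t₀ z ≠ 0 := by
  intro h0
  -- The forbidden region is open, so the nearby zero of the approximating polynomial still lies in
  -- it.
  have hopen : IsOpen {w : ℂ | 0 < w.im ∧ 1 - 2 * t₀ < w.im ^ 2} :=
    (isOpen_lt continuous_const Complex.continuous_im).inter
      (isOpen_lt continuous_const (Complex.continuous_im.pow 2))
  obtain ⟨r, hr, hball⟩ := Metric.nhds_basis_closedBall.mem_iff.1 (hopen.mem_nhds ⟨hz, hz'⟩)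
  obtain ⟨η, hη, hG⟩ := exists_zero_of_close (differentiable_H t₀) (H_zero_ne_zero t₀) h0 hr
  obtain ⟨N, ε, P, hε, hN, hP0, hPc, hPz, hPa⟩ :=
    exists_polynomial_approx_H ht₀ (R := ‖z‖ + r) (by positivity) hη
  obtain ⟨w, hw, hw0⟩ := hG _ ((Polynomial.verticalMean ε)^[N] P).differentiable fun w hw => by
    have := hPa N le_rfl w (by
      have h1 := norm_sub_norm_le w z
      have h2 := mem_closedBall_iff_norm.1 hw
      linarith)
    rwa [hN, mul_div_cancel_left₀ _ two_ne_zero] at this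
  have hw' := hball hw
  rcases Polynomial.im_sq_le_of_eval_iterate_verticalMean_eq_zero hP0 hPc hε
    (fun r hr => im_sq_le_one_of_H_zero_eq_zero (hPz r hr)) N w hw0 with h | h
  · exact hw'.1.ne' h
  · rw [hN] at h
    exact absurd hw'.2 (not_lt.2 h)

/-- The barrier criterion inside `|Re z| < X`, in quantitative form. -/
lemma H_ne_zero_of_barrier {t₀ X W y₀ m δ : ℝ} (ht₀ : 0 < t₀) (hX : 0 < X) (hW : 0 ≤ W)
    (hWy : 1 - y₀ ^ 2 ≤ W ^ 2) (hm : 0 < m) (hδ : 0 < δ) (hδt : δ ≤ 2 * t₀) (hδy : δ < y₀ ^ 2)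
    (hinit : ∀ z : ℂ, |z.re| ≤ X + W → z.im ^ 2 ≤ 1 → y₀ ^ 2 + 2 * t₀ - δ ≤ z.im ^ 2 → H 0 z ≠ 0)
    (hbar : ∀ t, 0 ≤ t → t ≤ t₀ → ∀ z : ℂ, X ≤ |z.re| → |z.re| ≤ X + W →
      y₀ ^ 2 + 2 * (t₀ - t) - δ ≤ z.im ^ 2 → z.im ^ 2 ≤ 1 - 2 * t → m ≤ ‖H t z‖)
    {z : ℂ} (hzX : |z.re| < X) (hz : y₀ ^ 2 ≤ z.im ^ 2) : H t₀ z ≠ 0 := by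
  intro h0
  have hopen : IsOpen {w : ℂ | |w.re| < X ∧ y₀ ^ 2 - δ < w.im ^ 2} :=
    (isOpen_lt Complex.continuous_re.abs continuous_const).inter
      (isOpen_lt continuous_const (Complex.continuous_im.pow 2))
  obtain ⟨r, hr, hball⟩ := Metric.nhds_basis_closedBall.mem_iff.1
    (hopen.mem_nhds (show z ∈ _ from ⟨hzX, by linarith⟩))
  obtain ⟨η, hη, hG⟩ := exists_zero_of_close (differentiable_H t₀) (H_zero_ne_zero t₀) h0 hr
  -- The radius covers the barrier, where |Im| ≤ 1, and an error of at most m/2 keeps the iterates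
  -- nonzero on it.
  obtain ⟨N, ε, P, hε, hN, hP0, hPc, hPz, hPa⟩ :=
    exists_polynomial_approx_H ht₀ (R := ‖z‖ + r + (X + W + 1)) (by positivity)
      (lt_min hη (half_pos hm))
  obtain ⟨w, hw, hw0⟩ := hG _ ((Polynomial.verticalMean ε)^[N] P).differentiable fun w hw => by
    have := hPa N le_rfl w (by
      have h1 := norm_sub_norm_le w z
      have h2 := mem_closedBall_iff_norm.1 hw
      linarith)
    rw [hN, mul_div_cancel_left₀ _ two_ne_zero] at this
    exact this.trans (min_le_left _ _)
  have hw' := hball hw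
  have hkey := Polynomial.im_sq_lt_of_eval_iterate_verticalMean_eq_zero (A := y₀ ^ 2 + 2 * t₀ - δ)
    (B := 1) (X := X) (W := W) (N := N) hP0 hPc hε hW
    (fun r hr => im_sq_le_one_of_H_zero_eq_zero (hPz r hr))
    (fun r hr hrX => by
      by_contra! hA
      exact hinit r hrX (im_sq_le_one_of_H_zero_eq_zero (hPz r hr)) hA (hPz r hr))
    -- B - A ≤ 1 - y₀² because δ ≤ 2t₀, and Nε² = 2t₀ < A because δ < y₀².
    (by linarith) (by linarith)
    (fun n hn r hr1 hr2 hr3 hr4 hr0 => by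
      have hnN : (n : ℝ) ≤ N := by exact_mod_cast hn
      have hn0 : 0 ≤ (n : ℝ) * ε ^ 2 := by positivity
      have hnt : (n : ℝ) * ε ^ 2 ≤ 2 * t₀ := by rw [← hN]; gcongr
      have h1 := hbar (n * ε ^ 2 / 2) (by linarith) (by linarith) r hr1 hr2 (by linarith) (by linarith)
      have him : |r.im| ≤ 1 := abs_le_one_iff_mul_self_le_one.2 (by nlinarith)
      have h2 := hPa n hn r (by
        have := Complex.norm_le_abs_re_add_abs_im r
        have := norm_nonneg z
        linarith)
      rw [hr0, zero_sub, norm_neg] at h2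
      have := h2.trans (min_le_right _ _)
      linarith) N le_rfl w hw0 (by linarith [hw'.1])
  rw [hN] at hkey
  linarith [hw'.2]

/-- The maximum of ‖H‖ and the height deficit is positive on a compact set. Its lower bound m serves
both as a margin for ‖H‖ and as the slack by which the barrier extends downwards. -/
lemma exists_barrier_bound {t₀ X W y₀ : ℝ} (h : ∀ t x y : ℝ, 0 ≤ t → t ≤ t₀ → X ≤ x → x ≤ X + W →
      √(y₀ ^ 2 + 2 * (t₀ - t)) ≤ y → y ≤ √(1 - 2 * t) →
      H t ((x : ℂ) + (y : ℂ) * Complex.I) ≠ 0) :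
    ∃ m : ℝ, 0 < m ∧ ∀ t, 0 ≤ t → t ≤ t₀ → ∀ z : ℂ, X ≤ |z.re| → |z.re| ≤ X + W →
      y₀ ^ 2 + 2 * (t₀ - t) - m < z.im ^ 2 → z.im ^ 2 ≤ 1 - 2 * t → m ≤ ‖H t z‖ := by
  set K : Set (ℝ × ℝ × ℝ) := (Icc 0 t₀ ×ˢ Icc X (X + W) ×ˢ Icc 0 1) ∩
    {p | p.2.2 ^ 2 ≤ 1 - 2 * p.1} with hK
  have hKc : IsCompact K := (isCompact_Icc.prod (isCompact_Icc.prod isCompact_Icc)).inter_right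
    (isClosed_le (by fun_prop) (by fun_prop))
  have hcont : Continuous fun p : ℝ × ℝ × ℝ =>
      max ‖H p.1 (p.2.1 + p.2.2 * Complex.I)‖ (y₀ ^ 2 + 2 * (t₀ - p.1) - p.2.2 ^ 2) := by
    refine Continuous.max ?_ (by fun_prop)
    exact (continuous_H.comp (g := fun p : ℝ × ℂ => H p.1 p.2)
      (f := fun p : ℝ × ℝ × ℝ => (p.1, (p.2.1 + p.2.2 * Complex.I : ℂ))) (by fun_prop)).norm
  obtain ⟨m, hm, hmK⟩ := hKc.exists_forall_le' (a := 0) hcont.continuousOn (by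
    rintro ⟨t, x, y⟩ ⟨⟨ht, hx, hy⟩, hyt⟩
    by_contra! hle
    have h2 : y₀ ^ 2 + 2 * (t₀ - t) - y ^ 2 ≤ 0 := (le_max_right _ _).trans hle
    have h1 : ‖H t (x + y * Complex.I)‖ ≤ 0 := (le_max_left _ _).trans hle
    exact h t x y ht.1 ht.2 hx.1 hx.2 (sqrt_le_iff.2 ⟨hy.1, by linarith⟩)
      (le_sqrt_of_sq_le hyt) (norm_le_zero_iff.1 h1))
  refine ⟨m, hm, fun t ht ht' z hz1 hz2 hz3 hz4 => ?_⟩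
  have him : |z.im| ≤ 1 := abs_le_one_iff_mul_self_le_one.2 (by nlinarith)
  have := hmK (t, |z.re|, |z.im|) ⟨⟨⟨ht, ht'⟩, ⟨hz1, hz2⟩, abs_nonneg _, him⟩, by
    show |z.im| ^ 2 ≤ 1 - 2 * t
    rwa [sq_abs]⟩
  simp only [norm_H_abs, sq_abs] at this
  rcases le_max_iff.1 this with h | h
  · exact h
  · linarith

lemma exists_initial_gap {a X : ℝ} (h : ∀ x y : ℝ, 0 ≤ x → x ≤ X → √a ≤ y → y ≤ 1 →
      H 0 ((x : ℂ) + (y : ℂ) * Complex.I) ≠ 0) :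
    ∃ m : ℝ, 0 < m ∧ ∀ z : ℂ, |z.re| ≤ X → z.im ^ 2 ≤ 1 → a - m < z.im ^ 2 → H 0 z ≠ 0 := by
  have hcont : Continuous fun p : ℝ × ℝ =>
      max ‖H 0 (p.1 + p.2 * Complex.I)‖ (a - p.2 ^ 2) := by
    refine Continuous.max ?_ (by fun_prop)
    exact ((differentiable_H 0).continuous.comp (by fun_prop)).norm
  obtain ⟨m, hm, hmK⟩ := (isCompact_Icc (a := (0 : ℝ)) (b := X)).prod
    (isCompact_Icc (a := (0 : ℝ)) (b := 1)) |>.exists_forall_le' (a := 0) hcont.continuousOn (by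
    rintro ⟨x, y⟩ ⟨hx, hy⟩
    by_contra! hle
    have h2 : a - y ^ 2 ≤ 0 := (le_max_right _ _).trans hle
    have h1 : ‖H 0 (x + y * Complex.I)‖ ≤ 0 := (le_max_left _ _).trans hle
    exact h x y hx.1 hx.2 (sqrt_le_iff.2 ⟨hy.1, by linarith⟩) hy.2 (norm_le_zero_iff.1 h1))
  refine ⟨m, hm, fun z hz1 hz2 hz3 h0 => ?_⟩
  have him : |z.im| ≤ 1 := abs_le_one_iff_mul_self_le_one.2 (by nlinarith)
  have := hmK (|z.re|, |z.im|) ⟨⟨abs_nonneg _, hz1⟩, abs_nonneg _, him⟩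
  simp only [norm_H_abs, sq_abs, h0, norm_zero] at this
  rcases le_max_iff.1 this with h | h <;> linarith

end DeBruijnNewman

theorem proposition3p3 (t₀ X y₀ : ℝ) (ht₀ : 0 < t₀) (hX : 0 < X) (hy₀ : 0 < y₀) (hy₀' : y₀ ≤ 1)
    (h_i : ∀ x y : ℝ, 0 ≤ x → x ≤ X →
      Real.sqrt (y₀ ^ 2 + 2 * t₀) ≤ y → y ≤ 1 →
      DeBruijnNewman.H 0 ((x : ℂ) + (y : ℂ) * Complex.I) ≠ 0)
    (h_ii : ∀ x y : ℝ, X + Real.sqrt (1 - y₀ ^ 2) ≤ x →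
      y₀ ≤ y → y ≤ Real.sqrt (1 - 2 * t₀) →
      DeBruijnNewman.H t₀ ((x : ℂ) + (y : ℂ) * Complex.I) ≠ 0)
    (h_iii : ∀ t x y : ℝ, 0 ≤ t → t ≤ t₀ →
      X ≤ x → x ≤ X + Real.sqrt (1 - y₀ ^ 2) →
      Real.sqrt (y₀ ^ 2 + 2 * (t₀ - t)) ≤ y → y ≤ Real.sqrt (1 - 2 * t) →
      DeBruijnNewman.H t ((x : ℂ) + (y : ℂ) * Complex.I) ≠ 0) :
    ∀ x y : ℝ, y₀ ≤ y → DeBruijnNewman.H t₀ ((x : ℂ) + (y : ℂ) * Complex.I) ≠ 0 := by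
  intro x y hy
  have hy0 : 0 < y := hy₀.trans_le hy
  set z : ℂ := (x : ℂ) + (y : ℂ) * Complex.I with hz
  have hre : z.re = x := by simp [hz]
  have him : z.im = y := by simp [hz]
  have habs := DeBruijnNewman.norm_H_abs t₀ z
  rw [hre, him, abs_of_pos hy0] at habs
  rcases lt_or_ge (1 - 2 * t₀) (y ^ 2) with hyt | hyt
  · exact DeBruijnNewman.H_ne_zero_of_lt_im_sq ht₀ (by rwa [him]) (by rwa [him])
  have hyt' : y ≤ Real.sqrt (1 - 2 * t₀) := Real.le_sqrt_of_sq_le hyt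
  set W := Real.sqrt (1 - y₀ ^ 2) with hW
  have hW2 : W ^ 2 = 1 - y₀ ^ 2 := Real.sq_sqrt (by nlinarith)
  rcases le_or_gt (X + W) |x| with hx | hx
  · rw [← norm_pos_iff, ← habs, norm_pos_iff]
    exact h_ii |x| y hx hy hyt'
  rcases le_or_gt X |x| with hxX | hxX
  · rw [← norm_pos_iff, ← habs, norm_pos_iff]
    refine h_iii t₀ |x| y ht₀.le le_rfl hxX hx.le ?_ hyt'
    rwa [sub_self, mul_zero, add_zero, Real.sqrt_sq hy₀.le]
  obtain ⟨m, hm, hbar⟩ := DeBruijnNewman.exists_barrier_bound h_iii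
  obtain ⟨m', hm', hinit⟩ := DeBruijnNewman.exists_initial_gap h_i
  obtain ⟨δ, hδ, hδ'⟩ : ∃ δ : ℝ, 0 < δ ∧ δ < min (min m m') (min (2 * t₀) (y₀ ^ 2)) :=
    exists_between (by positivity)
  simp only [lt_min_iff] at hδ'
  obtain ⟨⟨h1, h2⟩, h3, h4⟩ := hδ'
  refine DeBruijnNewman.H_ne_zero_of_barrier ht₀ hX (Real.sqrt_nonneg _) hW2.ge hm hδ h3.le h4 ?_ ?_
    (by rwa [hre]) (by rw [him]; gcongr)
  · intro w hw1 hw2 hw3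
    rcases le_total |w.re| X with hwX | hwX
    · exact hinit w hwX hw2 (by linarith)
    -- Hypothesis (iii) at t = 0 extends the initial zero-free region from |Re| ≤ X to the whole
    -- window.
    · exact norm_pos_iff.1
        (hm.trans_le (hbar 0 le_rfl ht₀.le w hwX hw1 (by linarith) (by linarith)))
  · intro t ht ht' w hw1 hw2 hw3 hw4
    exact hbar t ht ht' w hw1 hw2 (by linarith) hw4
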